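/- Let $m,n\ge 1$, $\Lambda^0_{m,n}=\{0,1,\dots,m\}\times\{0,1,\dots,n\}$, and let $\Omega=\Omega_{m,n}$ be the set of (full) triangulations of $\Lambda^0_{m,n}$, i.e. of maximal sets of pairwise non-crossing edges, where an edge is a straight line segment joining two distinct points of $\Lambda^0_{m,n}$ and passing through no other point of $\Lambda^0_{m,n}$. In every triangulation $\sigma$ the midpoints of the edges are exactly the points of $\Lambda_{m,n}=\big(\{0,\tfrac12,1,\dots,m\}\times\{0,\tfrac12,1,\dots,n\}\big)\setminus\Lambda^0_{m,n}$, each being the midpoint of exactly one edge; write $\sigma_x$ for the edge with midpoint $x$. For $\lambda>0$ let $\mu(\sigma)=\lambda^{|\sigma|}/Z$ with $Z=\sum_{\sigma\in\Omega}\lambda^{|\sigma|}$, where $|\sigma|$ is the total $\ell_1$-length of the edges of $\sigma$. The Glauber dynamics (without constraints) is the following Markov chain on $\Omega$: in state $\sigma$, pick $x\in\Lambda_{m,n}$ uniformly at random; if $\sigma_x$ is a diagonal of a parallelogram all of whose sides are edges of $\sigma$ and replacing $\sigma_x$ by the other diagonal gives a triangulation $\sigma'$, move to $\sigma'$ with probability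 $\mu(\sigma')/(\mu(\sigma')+\mu(\sigma))$; otherwise stay at $\sigma$. Let $p^t(\sigma,\cdot)$ be the distribution after $t$ steps started at $\sigma$, and let $$T_{\rm mix}=\inf\Big\{t\in\mathbb N:\ \max_{\sigma\in\Omega}\tfrac12\sum_{\tau\in\Omega}|p^t(\sigma,\tau)-\mu(\tau)|\le \tfrac14\Big\}.$$ Theorem. For every $\lambda>1$ there exists $c>0$, depending only on $\lambda$, such that $T_{\rm mix}\ge \exp(c\,(m+n))$ for all $m,n\ge 1$. -/

import Mathlib

namespace LatticeTriangulation

/-- The point set `{0,…,m} × {0,…,n}`; the first coordinate is vertical, the second horizontal. -/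
abbrev Pt (m n : ℕ) : Type := Fin (m + 1) × Fin (n + 1)

/-- A lattice point as a point of the real plane. -/
def pos {m n : ℕ} (p : Pt m n) : ℝ × ℝ := (((p.1 : ℕ) : ℝ), ((p.2 : ℕ) : ℝ))

/-- The closed straight line segment joining the two endpoints of `e`. -/
def seg {m n : ℕ} (e : Sym2 (Pt m n)) : Set (ℝ × ℝ) :=
  convexHull ℝ (pos '' {p : Pt m n | p ∈ e})

/-- `e` joins two distinct lattice points and passes through no other lattice point. -/
def IsEdge {m n : ℕ} (e : Sym2 (Pt m n)) : Prop :=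
  ¬ e.IsDiag ∧ ∀ p : Pt m n, pos p ∈ seg e → p ∈ e

/-- Two segments do not cross: they meet at most in a common endpoint. -/
def NonCrossing {m n : ℕ} (e f : Sym2 (Pt m n)) : Prop :=
  seg e ∩ seg f ⊆ pos '' {p : Pt m n | p ∈ e ∧ p ∈ f}

/-- A set of edges no two of which cross. -/
def IsNonCrossingSet {m n : ℕ} (σ : Finset (Sym2 (Pt m n))) : Prop :=
  (∀ e ∈ σ, IsEdge e) ∧ ∀ e ∈ σ, ∀ f ∈ σ, e ≠ f → NonCrossing e f

/-- The set `Ω` of full triangulations: the maximal sets of non-crossing edges. -/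
abbrev Triangulation (m n : ℕ) : Type :=
  {σ : Finset (Sym2 (Pt m n)) // Maximal IsNonCrossingSet σ}

noncomputable instance instFintypeTriangulation (m n : ℕ) : Fintype (Triangulation m n) :=
  Fintype.ofFinite _

/-- The `ℓ¹` length of a segment. -/
def edgeLength {m n : ℕ} : Sym2 (Pt m n) → ℕ :=
  Sym2.lift ⟨fun p q => Nat.dist p.1 q.1 + Nat.dist p.2 q.2, fun p q => by
    simp only [Nat.dist_comm (p.1 : ℕ) (q.1 : ℕ), Nat.dist_comm (p.2 : ℕ) (q.2 : ℕ)]⟩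

/-- The total length `|σ|`. -/
def totalLength {m n : ℕ} (σ : Triangulation m n) : ℕ := ∑ e ∈ σ.1, edgeLength e

/-- The partition function. -/
noncomputable def partitionFunction (lam : ℝ) (m n : ℕ) : ℝ :=
  ∑ σ : Triangulation m n, lam ^ totalLength σ

/-- The Gibbs distribution `μ`. -/
noncomputable def gibbs (lam : ℝ) {m n : ℕ} (σ : Triangulation m n) : ℝ :=
  lam ^ totalLength σ / partitionFunction lam m n

/-- The set `Λ` of midpoints, that is, the points of the half-integer lattice in the rectangle that
are not integer points. The pair `(i, j)` stands for the point `(i / 2, j / 2)`. -/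
def midpoints (m n : ℕ) : Finset (ℕ × ℕ) :=
  (Finset.range (2 * m + 1) ×ˢ Finset.range (2 * n + 1)).filter
    fun x => ¬ (Even x.1 ∧ Even x.2)

/-- `x` is the midpoint of the segment from `p` to `q` (coordinates of `x` are doubled). -/
def IsMidpoint {m n : ℕ} (x : ℕ × ℕ) (p q : Pt m n) : Prop :=
  (p.1 : ℕ) + (q.1 : ℕ) = x.1 ∧ (p.2 : ℕ) + (q.2 : ℕ) = x.2

/-- `τ` arises from `σ` by flipping the edge with midpoint `x`: that edge `ac` is a diagonal of a
parallelogram `abcd` whose sides are edges of `σ`, and it is replaced by the other diagonal `bd`. -/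
def IsFlipAt {m n : ℕ} (x : ℕ × ℕ) (σ τ : Triangulation m n) : Prop :=
  ∃ a b c d : Pt m n,
    IsMidpoint x a c ∧ IsMidpoint x b d ∧
    s(a, c) ∈ σ.1 ∧ s(a, b) ∈ σ.1 ∧ s(b, c) ∈ σ.1 ∧ s(c, d) ∈ σ.1 ∧ s(d, a) ∈ σ.1 ∧
    τ.1 = insert s(b, d) (σ.1.erase s(a, c))

open Classical in
/-- The heat-bath update at `x`: if the edge of `σ` at `x` can be flipped, giving `τ`, this is done
with probability `μ(τ) / (μ(τ) + μ(σ))`; otherwise nothing happens. -/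
noncomputable def siteUpdate (lam : ℝ) {m n : ℕ} (x : ℕ × ℕ) (σ τ : Triangulation m n) : ℝ :=
  if IsFlipAt x σ τ then gibbs lam τ / (gibbs lam τ + gibbs lam σ)
  else if τ = σ then
    1 - ∑ ρ : Triangulation m n,
      if IsFlipAt x σ ρ then gibbs lam ρ / (gibbs lam ρ + gibbs lam σ) else 0
  else 0

/-- The transition matrix of the Glauber dynamics: a midpoint is chosen uniformly at random from
`Λ` and updated. -/
noncomputable def glauber (lam : ℝ) (m n : ℕ) :
    Matrix (Triangulation m n) (Triangulation m n) ℝ :=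
  Matrix.of fun σ τ =>
    ((midpoints m n).card : ℝ)⁻¹ * ∑ x ∈ midpoints m n, siteUpdate lam x σ τ

/-- Total variation distance. -/
noncomputable def tvDist {m n : ℕ} (ν μ : Triangulation m n → ℝ) : ℝ :=
  (1 / 2) * ∑ σ : Triangulation m n, |ν σ - μ σ|

/-- The mixing time: the infimum of all `t ∈ ℕ` such that, from every initial state, the
distribution after `t` steps is within total variation distance `1/4` of `μ`
(the infimum of the empty set being `∞`). -/
noncomputable def mixingTime (lam : ℝ) (m n : ℕ) : ℕ∞ :=
  sInf {T : ℕ∞ | ∃ t : ℕ, T = (t : ℕ∞) ∧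
    ∀ σ : Triangulation m n, tvDist ((glauber lam m n ^ t) σ) (gibbs lam) ≤ 1 / 4}

end LatticeTriangulation

/-!
The proof exhibits a set of triangulations from which the dynamics cannot escape quickly.

Let `r = n / 3` and consider the trapezoid with vertices `(0, 0)`, `(0, r)`, `(1, n)`, `(1, n - r)`
(height first). The set `trap m n r` consists of the triangulations in which the sides of this
trapezoid are unions of edges. In such a triangulation the trapezoid is cut by strip edges, which
join `(0, a)` to `(1, b)`. Two strip edges are noncrossing exactly when their indices `(a, b)` are
comparable (`nonCrossing_strip_strip`), so the strip edges in the trapezoid form a maximal chain in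
the product order (`isMaxChain_chain`), and every maximal chain may occur, whatever happens outside
of the trapezoid (`exists_replace`).

Since `3 * r ≤ n`, a flip can leave the trap only through one of the two slanted sides of the
trapezoid, and only if the chain starts with a step to the right or ends with a step upwards
(`mem_chain_of_isFlipAt`): any other parallelogram sticks out of the rectangle. Moving the first
step of a chain of the first kind to its end is injective. It lengthens by one each of the strip
edges other than the left side, and there are at least `r` of these, while the right side, which is
as long as the left side, takes the place of the latter (`IsMaxChain.chainLength_rotate`). Chains of
the second kind are treated by duality. So the stationary probability, given the trap, of standing
at an exit is at most `2 / lam ^ r` (`escape_trap_le`). The trap has mass at most `1/2`, because it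
is disjoint from its mirror image (`sum_trap_le_half`), and the bottleneck inequality for finite
Markov chains (`bottleneck_bound`) gives a mixing time of at least `lam ^ r / 8`.

This settles the case in which `n ≥ m` is large. For the finitely many remaining `n ≥ m` it is
enough that the mixing time is at least `2` (`two_le_of_mixed`), and the case `m > n` follows by
transposition (`mixingTime_transposition_le`).
-/

namespace LatticeTriangulation

/-! ### A bottleneck bound for finite Markov chains -/

section MarkovChain

variable {α : Type*} [Fintype α] [DecidableEq α]

theorem pow_apply_nonneg {P : Matrix α α ℝ} (hP : ∀ x y, 0 ≤ P x y) (t : ℕ) (x y : α) :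
    0 ≤ (P ^ t) x y := by
  induction t generalizing y with
  | zero => rw [pow_zero, Matrix.one_apply]; split_ifs <;> norm_num
  | succ t ih =>
    rw [pow_succ, Matrix.mul_apply]
    exact Finset.sum_nonneg fun z _ => mul_nonneg (ih z) (hP z y)

theorem sum_pow_apply {P : Matrix α α ℝ} (hP : ∀ x, ∑ y, P x y = 1) (t : ℕ) (x : α) :
    ∑ y, (P ^ t) x y = 1 := by
  induction t with
  | zero => simp [Matrix.one_apply]
  | succ t ih =>
    simp_rw [pow_succ, Matrix.mul_apply]
    rw [Finset.sum_comm]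
    simp_rw [← Finset.mul_sum, hP, mul_one, ih]

theorem stationary_pow {P : Matrix α α ℝ} {π : α → ℝ}
    (hπ : ∀ y, ∑ x, π x * P x y = π y) (t : ℕ) (y : α) :
    ∑ x, π x * (P ^ t) x y = π y := by
  induction t generalizing y with
  | zero => simp [Matrix.one_apply]
  | succ t ih =>
    simp_rw [pow_succ, Matrix.mul_apply, Finset.mul_sum, ← mul_assoc]
    rw [Finset.sum_comm]
    simp_rw [← Finset.sum_mul, ih, hπ]

/-- Two probability vectors differ on an event by at most their total variation distance. -/
theorem sum_sub_le_half_sum_abs {ν π : α → ℝ} (h : ∑ x, ν x = ∑ x, π x) (A : Finset α) :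
    ∑ x ∈ A, π x - ∑ x ∈ A, ν x ≤ 1 / 2 * ∑ x, |ν x - π x| := by
  have h1 : ∑ x ∈ A, (π x - ν x) ≤ ∑ x ∈ A, |ν x - π x| :=
    Finset.sum_le_sum fun x _ => by rw [abs_sub_comm]; exact le_abs_self _
  have h2 : ∑ x ∈ Aᶜ, (ν x - π x) ≤ ∑ x ∈ Aᶜ, |ν x - π x| :=
    Finset.sum_le_sum fun x _ => le_abs_self _
  rw [Finset.sum_sub_distrib] at h1 h2
  have h3 := Finset.sum_add_sum_compl A ν
  have h4 := Finset.sum_add_sum_compl A π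
  have h5 := Finset.sum_add_sum_compl A fun x => |ν x - π x|
  linarith

/-- Started from stationarity restricted to `A`, the mass that has left `A` grows by at most the
stationary flow out of `A` in each step. -/
theorem escape_le {P : Matrix α α ℝ} {π : α → ℝ} (hP : ∀ x y, 0 ≤ P x y)
    (hP1 : ∀ x, ∑ y, P x y = 1) (hπ0 : ∀ x, 0 ≤ π x) (hπ : ∀ y, ∑ x, π x * P x y = π y)
    (A : Finset α) (t : ℕ) :
    ∑ x ∈ A, π x * ∑ y ∈ Aᶜ, (P ^ t) x y ≤ t * ∑ x ∈ A, π x * ∑ y ∈ Aᶜ, P x y := by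
  induction t with
  | zero =>
    rw [Nat.cast_zero, zero_mul]
    refine (Finset.sum_eq_zero fun x hx => ?_).le
    rw [Finset.sum_eq_zero, mul_zero]
    intro y hy
    rw [pow_zero, Matrix.one_apply_ne]
    rintro rfl
    exact Finset.mem_compl.1 hy hx
  | succ t ih =>
    set a : α → ℝ := fun z => ∑ x ∈ A, π x * (P ^ t) x z with ha
    have ha0 : ∀ z, 0 ≤ a z := fun z =>
      Finset.sum_nonneg fun x _ => mul_nonneg (hπ0 x) (pow_apply_nonneg hP t x z)
    have ha1 : ∀ z, a z ≤ π z := fun z => by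
      rw [← stationary_pow hπ t z]
      exact Finset.sum_le_sum_of_subset_of_nonneg (Finset.subset_univ _) fun x _ _ =>
        mul_nonneg (hπ0 x) (pow_apply_nonneg hP t x z)
    have hflow : ∀ z, 0 ≤ ∑ y ∈ Aᶜ, P z y := fun z => Finset.sum_nonneg fun y _ => hP z y
    have hflow1 : ∀ z, ∑ y ∈ Aᶜ, P z y ≤ 1 := fun z => by
      rw [← hP1 z]
      exact Finset.sum_le_sum_of_subset_of_nonneg (Finset.subset_univ _) fun y _ _ => hP z y
    have hstep : ∑ x ∈ A, π x * ∑ y ∈ Aᶜ, (P ^ (t + 1)) x y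
        = ∑ z, a z * ∑ y ∈ Aᶜ, P z y := by
      simp_rw [pow_succ, Matrix.mul_apply, ha, Finset.sum_mul]
      rw [Finset.sum_comm]
      refine Finset.sum_congr rfl fun x _ => ?_
      rw [Finset.sum_comm, Finset.mul_sum]
      refine Finset.sum_congr rfl fun z _ => ?_
      rw [← Finset.mul_sum, mul_assoc]
    have hout : ∑ z ∈ Aᶜ, a z = ∑ x ∈ A, π x * ∑ y ∈ Aᶜ, (P ^ t) x y := by
      simp_rw [ha, Finset.mul_sum]
      rw [Finset.sum_comm]
    rw [hstep, ← Finset.sum_add_sum_compl A]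
    have h1 : ∑ z ∈ A, a z * ∑ y ∈ Aᶜ, P z y ≤ ∑ z ∈ A, π z * ∑ y ∈ Aᶜ, P z y :=
      Finset.sum_le_sum fun z _ => mul_le_mul_of_nonneg_right (ha1 z) (hflow z)
    have h2 : ∑ z ∈ Aᶜ, a z * ∑ y ∈ Aᶜ, P z y ≤ ∑ z ∈ Aᶜ, a z :=
      Finset.sum_le_sum fun z _ => mul_le_of_le_one_right (ha0 z) (hflow1 z)
    push_cast
    linarith

/-- If a set `A` of stationary mass at most `1/2` has escape rate at most `Φ`, then a time `t` at
which all rows of `P ^ t` are within total variation distance `1/4` of stationarity satisfies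
`t * Φ ≥ 1/4`. -/
theorem bottleneck_bound {P : Matrix α α ℝ} {π : α → ℝ} (hP : ∀ x y, 0 ≤ P x y)
    (hP1 : ∀ x, ∑ y, P x y = 1) (hπ0 : ∀ x, 0 ≤ π x) (hπ1 : ∑ x, π x = 1)
    (hπ : ∀ y, ∑ x, π x * P x y = π y) {A : Finset α} (hApos : 0 < ∑ x ∈ A, π x)
    (hA : ∑ x ∈ A, π x ≤ 1 / 2) {Φ : ℝ}
    (hΦ : ∑ x ∈ A, π x * ∑ y ∈ Aᶜ, P x y ≤ Φ * ∑ x ∈ A, π x) {t : ℕ}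
    (ht : ∀ x, 1 / 2 * ∑ y, |(P ^ t) x y - π y| ≤ 1 / 4) : 1 / 4 ≤ t * Φ := by
  have hlow : ∀ x, 1 / 4 ≤ ∑ y ∈ Aᶜ, (P ^ t) x y := fun x => by
    have h1 := sum_sub_le_half_sum_abs ((sum_pow_apply hP1 t x).trans hπ1.symm) Aᶜ
    have h2 := Finset.sum_add_sum_compl A π
    have h3 := ht x
    linarith
  have h1 : ∑ x ∈ A, π x * (1 / 4) ≤ ∑ x ∈ A, π x * ∑ y ∈ Aᶜ, (P ^ t) x y :=
    Finset.sum_le_sum fun x _ => mul_le_mul_of_nonneg_left (hlow x) (hπ0 x)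
  rw [← Finset.sum_mul] at h1
  have h2 := h1.trans (escape_le hP hP1 hπ0 hπ A t)
  have h3 := h2.trans (mul_le_mul_of_nonneg_left hΦ (Nat.cast_nonneg t))
  rw [← mul_assoc, mul_comm] at h3
  exact le_of_mul_le_mul_right h3 hApos

end MarkovChain

/-! ### Segments, edges and crossings -/

section Geometry

variable {m n : ℕ}

theorem mem_seg {p q : Pt m n} {z : ℝ × ℝ} :
    z ∈ seg s(p, q) ↔ ∃ t : ℝ, 0 ≤ t ∧ t ≤ 1 ∧
      z.1 = (p.1 : ℕ) + t * (((q.1 : ℕ) : ℝ) - (p.1 : ℕ)) ∧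
      z.2 = (p.2 : ℕ) + t * (((q.2 : ℕ) : ℝ) - (p.2 : ℕ)) := by
  have h : {x : Pt m n | x ∈ s(p, q)} = {p, q} := by ext x; simp
  rw [seg, h, Set.image_pair, convexHull_pair, segment_eq_image']
  simp only [Set.mem_image, Set.mem_Icc, pos, Prod.ext_iff, Prod.fst_add, Prod.snd_add,
    Prod.smul_fst, Prod.smul_snd, Prod.fst_sub, Prod.snd_sub, smul_eq_mul]
  constructor
  · rintro ⟨t, ⟨h0, h1⟩, h2, h3⟩
    exact ⟨t, h0, h1, h2.symm, h3.symm⟩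
  · rintro ⟨t, h0, h1, h2, h3⟩
    exact ⟨t, ⟨h0, h1⟩, h2.symm, h3.symm⟩

theorem NonCrossing.symm {e f : Sym2 (Pt m n)} (h : NonCrossing e f) : NonCrossing f e := by
  intro z hz
  obtain ⟨p, hp, rfl⟩ := h hz.symm
  exact ⟨p, hp.symm, rfl⟩

/-- The lattice point `(i, j)`; the coordinates are meant to satisfy `i ≤ m` and `j ≤ n`. -/
def pt (m n i j : ℕ) : Pt m n := (Fin.ofNat (m + 1) i, Fin.ofNat (n + 1) j)

theorem pt_fst {i : ℕ} (hi : i ≤ m) (j : ℕ) : ((pt m n i j).1 : ℕ) = i :=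
  Nat.mod_eq_of_lt (Nat.lt_succ_of_le hi)

theorem pt_snd (i : ℕ) {j : ℕ} (hj : j ≤ n) : ((pt m n i j).2 : ℕ) = j :=
  Nat.mod_eq_of_lt (Nat.lt_succ_of_le hj)

theorem eq_pt {p : Pt m n} {i j : ℕ} (hi : (p.1 : ℕ) = i) (hj : (p.2 : ℕ) = j) :
    p = pt m n i j := by
  have h1 := p.1.2
  have h2 := p.2.2
  refine Prod.ext (Fin.ext ?_) (Fin.ext ?_)
  · rw [pt_fst (by omega), hi]
  · rw [pt_snd _ (by omega), hj]

/-- The segment joining `(0, a)` to `(1, b)`, where `x = (a, b)`. -/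
def strip (m n : ℕ) (x : ℕ × ℕ) : Sym2 (Pt m n) := s(pt m n 0 x.1, pt m n 1 x.2)

/-- The unit segment joining `(h, i)` to `(h, i + 1)`. -/
def hor (m n h i : ℕ) : Sym2 (Pt m n) := s(pt m n h i, pt m n h (i + 1))

theorem mem_seg_strip (hm : 1 ≤ m) {a b : ℕ} (ha : a ≤ n) (hb : b ≤ n) {z : ℝ × ℝ} :
    z ∈ seg (strip m n (a, b)) ↔ 0 ≤ z.1 ∧ z.1 ≤ 1 ∧ z.2 = a + z.1 * ((b : ℝ) - a) := by
  rw [strip, mem_seg, pt_fst (Nat.zero_le m), pt_fst hm, pt_snd _ ha, pt_snd _ hb]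
  simp only [Nat.cast_zero, Nat.cast_one, sub_zero, mul_one, zero_add]
  constructor
  · rintro ⟨t, h0, h1, rfl, h3⟩
    exact ⟨h0, h1, h3⟩
  · rintro ⟨h0, h1, h2⟩
    exact ⟨z.1, h0, h1, rfl, h2⟩

theorem mem_seg_hor {h i : ℕ} (hh : h ≤ m) (hi : i + 1 ≤ n) {z : ℝ × ℝ} :
    z ∈ seg (hor m n h i) ↔ z.1 = h ∧ (i : ℝ) ≤ z.2 ∧ z.2 ≤ i + 1 := by
  rw [hor, mem_seg, pt_fst hh, pt_fst hh, pt_snd _ hi, pt_snd _ (by omega)]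
  constructor
  · rintro ⟨t, h0, h1, h2, h3⟩
    push_cast at h3
    refine ⟨by rw [h2]; ring, by rw [h3]; linarith, by rw [h3]; linarith⟩
  · rintro ⟨h1, h2, h3⟩
    refine ⟨z.2 - i, by linarith, by linarith, by rw [h1]; ring, by push_cast; ring⟩

theorem strip_injOn (hm : 1 ≤ m) {x y : ℕ × ℕ} (hx1 : x.1 ≤ n) (hx2 : x.2 ≤ n) (hy1 : y.1 ≤ n)
    (hy2 : y.2 ≤ n) (h : strip m n x = strip m n y) : x = y := by
  rw [strip, strip, Sym2.eq_iff] at h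
  rcases h with ⟨h1, h2⟩ | ⟨h1, -⟩
  · have h3 := congrArg (fun p : Pt m n => (p.2 : ℕ)) h1
    have h4 := congrArg (fun p : Pt m n => (p.2 : ℕ)) h2
    simp only [pt_snd _ hx1, pt_snd _ hy1, pt_snd _ hx2, pt_snd _ hy2] at h3 h4
    exact Prod.ext h3 h4
  · have h3 := congrArg (fun p : Pt m n => (p.1 : ℕ)) h1
    simp [pt_fst (Nat.zero_le m), pt_fst hm] at h3

theorem edgeLength_strip (hm : 1 ≤ m) {a b : ℕ} (hab : a ≤ b) (hb : b ≤ n) :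
    edgeLength (strip m n (a, b)) = 1 + (b - a) := by
  simp only [strip, edgeLength, Sym2.lift_mk, pt_fst (Nat.zero_le m), pt_fst hm, pt_snd _ hb,
    pt_snd _ (hab.trans hb), Nat.dist]
  omega

theorem isEdge_strip (hm : 1 ≤ m) {a b : ℕ} (ha : a ≤ n) (hb : b ≤ n) :
    IsEdge (strip m n (a, b)) := by
  constructor
  · rw [strip, Sym2.mk_isDiag_iff]
    intro h
    have h3 := congrArg (fun p : Pt m n => (p.1 : ℕ)) h
    simp [pt_fst (Nat.zero_le m), pt_fst hm] at h3
  · intro p hp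
    rw [mem_seg_strip hm ha hb] at hp
    simp only [pos] at hp
    obtain ⟨-, h1, h2⟩ := hp
    rw [strip, Sym2.mem_iff]
    have h1' : (p.1 : ℕ) ≤ 1 := by exact_mod_cast h1
    rcases Nat.le_one_iff_eq_zero_or_eq_one.1 h1' with h | h
    · left
      rw [h] at h2
      exact eq_pt h (by simpa using h2)
    · right
      rw [h] at h2
      exact eq_pt h (by simpa using h2)

theorem isEdge_hor {h i : ℕ} (hh : h ≤ m) (hi : i + 1 ≤ n) : IsEdge (hor m n h i) := by
  constructor
  · rw [hor, Sym2.mk_isDiag_iff]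
    intro h'
    have h3 := congrArg (fun p : Pt m n => (p.2 : ℕ)) h'
    simp [pt_snd _ hi, pt_snd _ (show i ≤ n by omega)] at h3
  · intro p hp
    rw [mem_seg_hor hh hi] at hp
    simp only [pos] at hp
    obtain ⟨h1, h2, h3⟩ := hp
    have h1' : (p.1 : ℕ) = h := by exact_mod_cast h1
    have h2' : i ≤ (p.2 : ℕ) := by exact_mod_cast h2
    have h3' : (p.2 : ℕ) ≤ i + 1 := by exact_mod_cast h3
    rw [hor, Sym2.mem_iff]
    rcases Nat.le_and_le_add_one_iff.1 ⟨h2', h3'⟩ with h4 | h4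
    · exact Or.inl (eq_pt h1' h4)
    · exact Or.inr (eq_pt h1' h4)

/-- An edge between two points of the same height is a unit segment. -/
theorem IsEdge.snd_eq_succ {p q : Pt m n} (he : IsEdge s(p, q)) (h : p.1 = q.1)
    (hlt : (p.2 : ℕ) < q.2) : (q.2 : ℕ) = p.2 + 1 := by
  by_contra hne
  have hq := q.2.2
  have hmem : pos (pt m n p.1 (p.2 + 1)) ∈ seg s(p, q) := by
    rw [mem_seg]
    have hpos : (0 : ℝ) < ((q.2 : ℕ) : ℝ) - (p.2 : ℕ) := by
      rw [sub_pos]; exact_mod_cast hlt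
    have h1 : (1 : ℝ) ≤ ((q.2 : ℕ) : ℝ) - (p.2 : ℕ) := by
      rw [le_sub_iff_add_le, add_comm]; exact_mod_cast hlt
    refine ⟨1 / (((q.2 : ℕ) : ℝ) - (p.2 : ℕ)), by positivity, ?_, ?_, ?_⟩
    · rw [div_le_one hpos]; exact h1
    · simp only [pos]
      rw [pt_fst (by omega), h]; simp
    · simp only [pos]
      rw [pt_snd _ (by omega), one_div, inv_mul_cancel₀ hpos.ne']; simp
  rcases Sym2.mem_iff.1 (he.2 _ hmem) with h1 | h1
  · have h3 := congrArg (fun p : Pt m n => (p.2 : ℕ)) h1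
    simp only [pt_snd _ (show (p.2 : ℕ) + 1 ≤ n by omega)] at h3
    omega
  · have h3 := congrArg (fun p : Pt m n => (p.2 : ℕ)) h1
    simp only [pt_snd _ (show (p.2 : ℕ) + 1 ≤ n by omega)] at h3
    omega

/-- The abscissa at which the edge from `(0, j)` to `(h, l)` meets height one, multiplied by `h`,
is `(h - 1) * j + l`; if that abscissa is an integer, the edge ends there. -/
theorem IsEdge.pt_one_eq (hm : 1 ≤ m) {p q : Pt m n} (he : IsEdge s(p, q)) (hp : (p.1 : ℕ) = 0)
    (hq : 1 ≤ (q.1 : ℕ)) {b : ℕ} (hb : b ≤ n)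
    (h : (q.1 * b : ℤ) = (q.1 - 1) * p.2 + q.2) : pt m n 1 b = q := by
  have hq' : (1 : ℝ) ≤ (q.1 : ℕ) := by exact_mod_cast hq
  have h' : ((q.1 : ℕ) : ℝ) * b = (((q.1 : ℕ) : ℝ) - 1) * (p.2 : ℕ) + (q.2 : ℕ) := by
    exact_mod_cast h
  have : pos (pt m n 1 b) ∈ seg s(p, q) := by
    rw [mem_seg]
    refine ⟨1 / ((q.1 : ℕ) : ℝ), by positivity, by rw [div_le_one (by linarith)]; exact hq',
      ?_, ?_⟩
    · simp only [pos]
      rw [pt_fst hm, hp, Nat.cast_zero, sub_zero, zero_add]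
      field_simp
      simp
    · simp only [pos]
      rw [pt_snd _ hb]
      field_simp
      linarith
  rcases Sym2.mem_iff.1 (he.2 _ this) with h2 | h2
  · rw [← h2, pt_fst hm] at hp
    omega
  · exact h2

/-- An edge starting at height zero that is weakly on one side of a strip edge at heights zero and
one does not cross it. -/
theorem nonCrossing_strip (hm : 1 ≤ m) {p q : Pt m n} (he : IsEdge s(p, q)) (hp : (p.1 : ℕ) = 0)
    (hq : 1 ≤ (q.1 : ℕ)) {a b : ℕ} (ha : a ≤ n) (hb : b ≤ n)
    (hne : s(p, q) ≠ strip m n (a, b))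
    (hside : (p.2 : ℕ) ≤ a ∧ (q.1 - 1 : ℤ) * p.2 + q.2 ≤ q.1 * b ∨
      a ≤ (p.2 : ℕ) ∧ (q.1 * b : ℤ) ≤ (q.1 - 1) * p.2 + q.2) :
    NonCrossing s(p, q) (strip m n (a, b)) := by
  rintro z ⟨hz, hz'⟩
  have hz'' := hz
  rw [mem_seg_strip hm ha hb] at hz'
  rw [mem_seg, hp] at hz
  obtain ⟨t, -, -, ht1, ht2⟩ := hz
  obtain ⟨z0, z1, hz2⟩ := hz'
  have hq' : (1 : ℝ) ≤ (q.1 : ℕ) := by exact_mod_cast hq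
  have hside' : ((p.2 : ℕ) : ℝ) ≤ a ∧
      (((q.1 : ℕ) : ℝ) - 1) * (p.2 : ℕ) + (q.2 : ℕ) ≤ (q.1 : ℕ) * b ∨
      (a : ℝ) ≤ (p.2 : ℕ) ∧
      ((q.1 : ℕ) : ℝ) * b ≤ (((q.1 : ℕ) : ℝ) - 1) * (p.2 : ℕ) + (q.2 : ℕ) := by
    exact_mod_cast hside
  set j : ℝ := ((p.2 : ℕ) : ℝ) with hj
  set h : ℝ := ((q.1 : ℕ) : ℝ) with hh
  set l : ℝ := ((q.2 : ℕ) : ℝ) with hl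
  simp only [Nat.cast_zero, sub_zero, zero_add] at ht1
  have key : (1 - z.1) * (h * (a - j)) + z.1 * (h * b - ((h - 1) * j + l)) = 0 := by
    have : h * z.2 = h * (j + t * (l - j)) := by rw [ht2]
    rw [hz2] at this
    have h3 : h * (t * (l - j)) = z.1 * (l - j) := by rw [ht1]; ring
    linear_combination this + h3
  have hboth : (1 - z.1) * (h * (a - j)) = 0 ∧ z.1 * (h * b - ((h - 1) * j + l)) = 0 := by
    rcases hside' with ⟨h1, h2⟩ | ⟨h1, h2⟩
    · have e1 : 0 ≤ (1 - z.1) * (h * (a - j)) :=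
        mul_nonneg (by linarith) (mul_nonneg (by linarith) (by linarith))
      have e2 : 0 ≤ z.1 * (h * b - ((h - 1) * j + l)) := mul_nonneg z0 (by linarith)
      constructor <;> linarith
    · have e1 : 0 ≤ (1 - z.1) * (h * (j - a)) :=
        mul_nonneg (by linarith) (mul_nonneg (by linarith) (by linarith))
      have e2 : 0 ≤ z.1 * (((h - 1) * j + l) - h * b) := mul_nonneg z0 (by linarith)
      constructor <;> linarith
  have hone : h * b = (h - 1) * j + l → pt m n 1 b = q := fun h1 =>
    he.pt_one_eq hm hp hq hb (by rw [hh, hj, hl] at h1; exact_mod_cast h1)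
  obtain ⟨hA, hB⟩ := hboth
  rcases eq_or_ne z.1 1 with h1 | h1
  · have h2 := hone (by rw [h1] at hB; linarith)
    refine ⟨q, ⟨by simp, by rw [strip, h2]; simp⟩, ?_⟩
    rw [← h2]
    refine Prod.ext ?_ ?_
    · simp only [pos]; rw [pt_fst hm, h1]; simp
    · simp only [pos]; rw [pt_snd _ hb, hz2, h1]; ring
  · have haj : (a : ℝ) = j := by
      rcases mul_eq_zero.1 hA with h2 | h2
      · exact absurd (by linarith) h1
      · rcases mul_eq_zero.1 h2 with h3 | h3 <;> linarith
    have hp' : p = pt m n 0 a := eq_pt hp (by rw [hj] at haj; exact_mod_cast haj.symm)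
    rcases mul_eq_zero.1 hB with h2 | h2
    · refine ⟨p, ⟨by simp, by rw [strip, hp']; simp⟩, ?_⟩
      refine Prod.ext ?_ ?_
      · simp only [pos]; rw [hp, h2]; simp
      · simp only [pos]; rw [hz2, h2, haj]; simp [hj]
    · exact absurd (by rw [strip, hone (by linarith), hp']) hne

/-- An edge strictly on different sides of a strip edge at heights zero and one crosses it. -/
theorem not_nonCrossing_strip (hm : 1 ≤ m) {p q : Pt m n} (hp : (p.1 : ℕ) = 0)
    (hq : 1 ≤ (q.1 : ℕ)) {a b : ℕ} (ha : a ≤ n) (hb : b ≤ n)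
    (hside : (p.2 : ℕ) < a ∧ (q.1 * b : ℤ) < (q.1 - 1) * p.2 + q.2 ∨
      a < (p.2 : ℕ) ∧ (q.1 - 1 : ℤ) * p.2 + q.2 < q.1 * b) :
    ¬ NonCrossing s(p, q) (strip m n (a, b)) := by
  intro hnc
  have hq' : (1 : ℝ) ≤ (q.1 : ℕ) := by exact_mod_cast hq
  have hside' : ((p.2 : ℕ) : ℝ) < a ∧
      ((q.1 : ℕ) : ℝ) * b < (((q.1 : ℕ) : ℝ) - 1) * (p.2 : ℕ) + (q.2 : ℕ) ∨
      (a : ℝ) < (p.2 : ℕ) ∧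
      (((q.1 : ℕ) : ℝ) - 1) * (p.2 : ℕ) + (q.2 : ℕ) < ((q.1 : ℕ) : ℝ) * b := by
    exact_mod_cast hside
  set j : ℝ := ((p.2 : ℕ) : ℝ) with hj
  set h : ℝ := ((q.1 : ℕ) : ℝ) with hh
  set l : ℝ := ((q.2 : ℕ) : ℝ) with hl
  have hpos : (0 : ℝ) < h := by linarith
  -- The height of the crossing point.
  obtain ⟨t, ht0, ht1, ht⟩ : ∃ t : ℝ, 0 < t ∧ t < 1 ∧
      (1 - t) * (h * (a - j)) = t * ((h - 1) * j + l - h * b) := by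
    have aux : ∀ X Y : ℝ, 0 < X → 0 < Y → ∃ t : ℝ, 0 < t ∧ t < 1 ∧ (1 - t) * X = t * Y := by
      intro X Y hX hY
      refine ⟨X / (X + Y), by positivity, ?_, ?_⟩
      · rw [div_lt_one (by positivity)]; linarith
      · field_simp; ring
    rcases hside' with ⟨h1, h2⟩ | ⟨h1, h2⟩
    · exact aux _ _ (mul_pos hpos (by linarith)) (by linarith)
    · obtain ⟨t, ht0, ht1, ht⟩ := aux (h * (j - a)) (h * b - ((h - 1) * j + l))
        (mul_pos hpos (by linarith)) (by linarith)
      exact ⟨t, ht0, ht1, by linarith⟩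
  have hz : ((t, a + t * ((b : ℝ) - a)) : ℝ × ℝ) ∈ seg s(p, q) ∩ seg (strip m n (a, b)) := by
    constructor
    · rw [mem_seg]
      refine ⟨t / h, by positivity, by rw [div_le_one hpos]; linarith, ?_, ?_⟩
      · rw [hp, Nat.cast_zero, sub_zero, zero_add, ← hh]; field_simp
      · rw [← hj, ← hl]; field_simp; linarith
    · rw [mem_seg_strip hm ha hb]
      exact ⟨ht0.le, ht1.le, rfl⟩
  obtain ⟨x, -, hx⟩ := hnc hz
  have hx1 : ((x.1 : ℕ) : ℝ) = t := congrArg Prod.fst hx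
  rw [← hx1] at ht0 ht1
  have h0 : 0 < (x.1 : ℕ) := by exact_mod_cast ht0
  have h1 : (x.1 : ℕ) < 1 := by exact_mod_cast ht1
  omega

/-- An edge starting at height zero and noncrossing with a unit segment at height one does not pass
strictly between its endpoints. -/
theorem not_between_of_nonCrossing_hor (hm : 1 ≤ m) {p q : Pt m n} (hp : (p.1 : ℕ) = 0)
    (hq : 1 ≤ (q.1 : ℕ)) {i : ℕ} (hi : i + 1 ≤ n)
    (hnc : NonCrossing s(p, q) (hor m n 1 i)) :
    ¬ ((q.1 * i : ℤ) < (q.1 - 1) * p.2 + q.2 ∧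
      (q.1 - 1 : ℤ) * p.2 + q.2 < q.1 * (i + 1)) := by
  intro hlt
  have hq' : (1 : ℝ) ≤ (q.1 : ℕ) := by exact_mod_cast hq
  have hlt' : ((q.1 : ℕ) : ℝ) * i < (((q.1 : ℕ) : ℝ) - 1) * (p.2 : ℕ) + (q.2 : ℕ) ∧
      (((q.1 : ℕ) : ℝ) - 1) * (p.2 : ℕ) + (q.2 : ℕ) < ((q.1 : ℕ) : ℝ) * (i + 1) := by
    exact_mod_cast hlt
  set j : ℝ := ((p.2 : ℕ) : ℝ) with hj
  set h : ℝ := ((q.1 : ℕ) : ℝ) with hh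
  set l : ℝ := ((q.2 : ℕ) : ℝ) with hl
  have hpos : (0 : ℝ) < h := by linarith
  obtain ⟨h1, h2⟩ := hlt'
  have e1 : (i : ℝ) < ((h - 1) * j + l) / h := by rw [lt_div_iff₀ hpos]; linarith
  have e2 : ((h - 1) * j + l) / h < i + 1 := by rw [div_lt_iff₀ hpos]; linarith
  have hz : ((1, ((h - 1) * j + l) / h) : ℝ × ℝ) ∈ seg s(p, q) ∩ seg (hor m n 1 i) := by
    constructor
    · rw [mem_seg]
      refine ⟨1 / h, by positivity, by rw [div_le_one hpos]; exact hq', ?_, ?_⟩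
      · rw [hp, Nat.cast_zero, sub_zero, zero_add, ← hh]; field_simp
      · rw [← hj, ← hl]; field_simp; ring
    · rw [mem_seg_hor hm hi]
      exact ⟨by simp, e1.le, e2.le⟩
  obtain ⟨x, -, hx⟩ := hnc hz
  have hx1 : ((x.2 : ℕ) : ℝ) = ((h - 1) * j + l) / h := congrArg Prod.snd hx
  rw [← hx1] at e1 e2
  have e1' : i < (x.2 : ℕ) := by exact_mod_cast e1
  have e2' : (x.2 : ℕ) < i + 1 := by exact_mod_cast e2
  omega

theorem nonCrossing_strip_of_one_le (hm : 1 ≤ m) {p q : Pt m n} (he : IsEdge s(p, q))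
    (hp : 1 ≤ (p.1 : ℕ)) (hq : 1 ≤ (q.1 : ℕ)) {a b : ℕ} (ha : a ≤ n) (hb : b ≤ n) :
    NonCrossing s(p, q) (strip m n (a, b)) := by
  rintro z ⟨hz, hz'⟩
  have hz'' := hz
  rw [mem_seg_strip hm ha hb] at hz'
  rw [mem_seg] at hz
  obtain ⟨t, t0, t1, ht1, -⟩ := hz
  obtain ⟨-, z1, hz2⟩ := hz'
  have hp' : (1 : ℝ) ≤ (p.1 : ℕ) := by exact_mod_cast hp
  have hq' : (1 : ℝ) ≤ (q.1 : ℕ) := by exact_mod_cast hq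
  have h1 : z.1 = 1 := by nlinarith
  have h2 : pos (pt m n 1 b) = z := by
    refine Prod.ext ?_ ?_
    · simp only [pos]; rw [pt_fst hm, h1]; simp
    · simp only [pos]; rw [pt_snd _ hb, hz2, h1]; ring
  exact ⟨pt m n 1 b, ⟨he.2 _ (h2 ▸ hz''), by simp [strip]⟩, h2⟩

theorem nonCrossing_strip_of_eq_zero (hm : 1 ≤ m) {p q : Pt m n} (he : IsEdge s(p, q))
    (hp : (p.1 : ℕ) = 0) (hq : (q.1 : ℕ) = 0) {a b : ℕ} (ha : a ≤ n) (hb : b ≤ n) :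
    NonCrossing s(p, q) (strip m n (a, b)) := by
  rintro z ⟨hz, hz'⟩
  have hz'' := hz
  rw [mem_seg_strip hm ha hb] at hz'
  rw [mem_seg, hp, hq] at hz
  obtain ⟨t, -, -, ht1, -⟩ := hz
  obtain ⟨-, -, hz2⟩ := hz'
  have h1 : z.1 = 0 := by simpa using ht1
  have h2 : pos (pt m n 0 a) = z := by
    refine Prod.ext ?_ ?_
    · simp only [pos]; rw [pt_fst (Nat.zero_le m), h1]; simp
    · simp only [pos]; rw [pt_snd _ ha, hz2, h1]; ring
  exact ⟨pt m n 0 a, ⟨he.2 _ (h2 ▸ hz''), by simp [strip]⟩, h2⟩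

/-- Two strip edges are noncrossing exactly when they are comparable in the product order. -/
theorem nonCrossing_strip_strip (hm : 1 ≤ m) {x y : ℕ × ℕ} (hx1 : x.1 ≤ n) (hx2 : x.2 ≤ n)
    (hy1 : y.1 ≤ n) (hy2 : y.2 ≤ n) (hne : x ≠ y) :
    NonCrossing (strip m n x) (strip m n y) ↔ x ≤ y ∨ y ≤ x := by
  have p0 : ((pt m n 0 x.1).1 : ℕ) = 0 := pt_fst (Nat.zero_le m) _
  have q1 : ((pt m n 1 x.2).1 : ℕ) = 1 := pt_fst hm _
  have p2 : ((pt m n 0 x.1).2 : ℕ) = x.1 := pt_snd _ hx1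
  have q2 : ((pt m n 1 x.2).2 : ℕ) = x.2 := pt_snd _ hx2
  constructor
  · intro h
    by_contra hcon
    refine not_nonCrossing_strip hm p0 q1.ge hy1 hy2 ?_ h
    rw [q1, p2, q2]
    simp only [Prod.le_def, not_or, not_and_or, not_le] at hcon
    push_cast
    omega
  · intro h
    refine nonCrossing_strip hm (isEdge_strip hm hx1 hx2) p0 q1.ge hy1 hy2
      (fun h' => hne (strip_injOn hm hx1 hx2 hy1 hy2 h')) ?_
    rw [q1, p2, q2]
    simp only [Prod.le_def] at h
    push_cast
    omega

theorem nonCrossing_hor_hor {h i h' i' : ℕ} (hh : h ≤ m) (hi : i + 1 ≤ n) (hh' : h' ≤ m)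
    (hi' : i' + 1 ≤ n) (hne : (h, i) ≠ (h', i')) : NonCrossing (hor m n h i) (hor m n h' i') := by
  rintro z ⟨hz, hz'⟩
  rw [mem_seg_hor hh hi] at hz
  rw [mem_seg_hor hh' hi'] at hz'
  obtain ⟨h1, h2, h3⟩ := hz
  obtain ⟨h1', h2', h3'⟩ := hz'
  have hhh : h = h' := by rw [h1] at h1'; exact_mod_cast h1'
  subst hhh
  have h4 : i ≤ i' + 1 := by exact_mod_cast h2.trans h3'
  have h5 : i' ≤ i + 1 := by exact_mod_cast h2'.trans h3
  have h6 : i ≠ i' := fun h => hne (by rw [h])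
  rcases (by omega : i = i' + 1 ∨ i' = i + 1) with rfl | rfl
  · refine ⟨pt m n h (i' + 1), ⟨by simp [hor], by simp [hor]⟩, ?_⟩
    refine Prod.ext ?_ ?_
    · simp only [pos]; rw [pt_fst hh, h1]
    · simp only [pos]; rw [pt_snd _ hi']; push_cast at *; linarith
  · refine ⟨pt m n h (i + 1), ⟨by simp [hor], by simp [hor]⟩, ?_⟩
    refine Prod.ext ?_ ?_
    · simp only [pos]; rw [pt_fst hh, h1]
    · simp only [pos]; rw [pt_snd _ hi]; push_cast at *; linarith

end Geometry

/-! ### Maximal chains in a product of two chains -/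

/-- The index set `[0, r] × [n - r, n]` of the strip edges in the trapezoid with vertices `(0, 0)`,
`(0, r)`, `(1, n)`, `(1, n - r)`. -/
def inner (n r : ℕ) : Finset (ℕ × ℕ) := Finset.range (r + 1) ×ˢ Finset.Icc (n - r) n

theorem mem_inner {n r : ℕ} {x : ℕ × ℕ} : x ∈ inner n r ↔ x.1 ≤ r ∧ n - r ≤ x.2 ∧ x.2 ≤ n := by
  simp [inner]

/-- `C` is a maximal chain of `inner n r` in the product order. -/
structure IsMaxChain (n r : ℕ) (C : Finset (ℕ × ℕ)) : Prop where
  subset : C ⊆ inner n r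
  total : ∀ x ∈ C, ∀ y ∈ C, x ≤ y ∨ y ≤ x
  maximal : ∀ x ∈ inner n r, (∀ y ∈ C, x ≤ y ∨ y ≤ x) → x ∈ C

section Chains

variable {n r : ℕ} {C : Finset (ℕ × ℕ)}

theorem IsMaxChain.bot_mem (hC : IsMaxChain n r C) : (0, n - r) ∈ C := by
  refine hC.maximal _ (mem_inner.2 (by simp)) fun y hy => Or.inl ?_
  have := mem_inner.1 (hC.subset hy)
  exact ⟨Nat.zero_le _, this.2.1⟩

theorem IsMaxChain.top_mem (hC : IsMaxChain n r C) : (r, n) ∈ C := by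
  refine hC.maximal _ (mem_inner.2 (by simp)) fun y hy => Or.inr ?_
  have := mem_inner.1 (hC.subset hy)
  exact ⟨this.1, this.2.2⟩

/-- A maximal chain meets every column. -/
theorem IsMaxChain.exists_mem (hC : IsMaxChain n r C) {a : ℕ} (ha : a ≤ r) :
    ∃ b, (a, b) ∈ C := by
  -- the highest point of the chain weakly to the left of column `a`
  obtain ⟨x, hx, hmax⟩ := Finset.exists_max_image (C.filter fun x => x.1 ≤ a) (fun x => x.2)
    ⟨(0, n - r), by simp [hC.bot_mem]⟩
  rw [Finset.mem_filter] at hx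
  have hxi := mem_inner.1 (hC.subset hx.1)
  refine ⟨x.2, hC.maximal _ (mem_inner.2 ⟨ha, hxi.2⟩) fun y hy => ?_⟩
  rcases le_or_gt y.1 a with h | h
  · exact Or.inr ⟨h, hmax y (Finset.mem_filter.2 ⟨hy, h⟩)⟩
  · rcases hC.total x hx.1 y hy with h1 | h1
    · exact Or.inl ⟨h.le, h1.2⟩
    · have := h1.1
      omega

theorem IsMaxChain.lt_card (hC : IsMaxChain n r C) : r < C.card := by
  have h : Finset.range (r + 1) ⊆ C.image Prod.fst := fun a ha => by
    obtain ⟨b, hb⟩ := hC.exists_mem (Nat.lt_succ_iff.1 (Finset.mem_range.1 ha))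
    exact Finset.mem_image.2 ⟨_, hb, rfl⟩
  have h1 := (Finset.card_le_card h).trans Finset.card_image_le
  rwa [Finset.card_range] at h1

/-- The total length of the strip edges with indices in `C`, if these indices `(a, b)` satisfy
`a ≤ b`. -/
def chainLength (C : Finset (ℕ × ℕ)) : ℕ := ∑ x ∈ C, (1 + (x.2 - x.1))

/-- Moving the first step of a chain that starts with a step to the right to its end: all points
but the least are moved one column to the left, and the greatest point is added. -/
def rotate (n r : ℕ) (C : Finset (ℕ × ℕ)) : Finset (ℕ × ℕ) :=
  insert (r, n) ((C.erase (0, n - r)).image fun x => (x.1 - 1, x.2))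

theorem IsMaxChain.one_le_fst (hC : IsMaxChain n r C) (h1 : (1, n - r) ∈ C) {x : ℕ × ℕ}
    (hx : x ∈ C.erase (0, n - r)) : 1 ≤ x.1 := by
  rw [Finset.mem_erase] at hx
  have hxi := mem_inner.1 (hC.subset hx.2)
  by_contra h
  refine hx.1 (Prod.ext (by simpa using h) ?_)
  rcases hC.total _ hx.2 _ h1 with h2 | h2
  · exact le_antisymm h2.2 hxi.2.1
  · have := h2.1
    simp only at this
    omega

theorem IsMaxChain.mem_rotate (hC : IsMaxChain n r C) (h1 : (1, n - r) ∈ C) {x : ℕ × ℕ} :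
    x ∈ rotate n r C ↔ x = (r, n) ∨ (x.1 + 1, x.2) ∈ C := by
  rw [rotate, Finset.mem_insert, Finset.mem_image]
  refine or_congr Iff.rfl ⟨?_, fun h => ⟨_, Finset.mem_erase.2 ⟨?_, h⟩, ?_⟩⟩
  · rintro ⟨y, hy, rfl⟩
    have h2 := hC.one_le_fst h1 hy
    rw [Nat.sub_add_cancel h2]
    exact Finset.mem_of_mem_erase hy
  · simp
  · simp

theorem IsMaxChain.isMaxChain_rotate (hC : IsMaxChain n r C) (h1 : (1, n - r) ∈ C) :
    IsMaxChain n r (rotate n r C) := by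
  have hsub : rotate n r C ⊆ inner n r := fun x hx => by
    rcases (hC.mem_rotate h1).1 hx with rfl | h
    · simp [mem_inner]
    · have := mem_inner.1 (hC.subset h)
      exact mem_inner.2 ⟨by simp only at this; omega, this.2⟩
  have htop : ∀ x ∈ rotate n r C, x ≤ (r, n) := fun x hx => by
    have := mem_inner.1 (hsub hx)
    exact ⟨this.1, this.2.2⟩
  refine ⟨hsub, fun x hx y hy => ?_, fun x hx hcomp => ?_⟩
  · rcases (hC.mem_rotate h1).1 hx with h | hx'
    · exact Or.inr (h ▸ htop y hy)
    rcases (hC.mem_rotate h1).1 hy with h | hy'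
    · exact Or.inl (h ▸ htop x hx)
    have := hC.total _ hx' _ hy'
    simp only [Prod.le_def] at this ⊢
    omega
  · have hxi := mem_inner.1 hx
    have hr1 : 1 ≤ r := (mem_inner.1 (hC.subset h1)).1
    rw [hC.mem_rotate h1]
    rcases hxi.1.eq_or_lt with h | h
    · left
      -- `(r - 1, n)` belongs to the new chain, so a point of the last column is the top one
      have h2 : (r - 1, n) ∈ rotate n r C := by
        rw [hC.mem_rotate h1]
        right
        rw [Nat.sub_add_cancel hr1]
        exact hC.top_mem
      have h3 := hcomp _ h2
      simp only [Prod.le_def] at h3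
      exact Prod.ext h (by simp only; omega)
    · right
      refine hC.maximal _ (mem_inner.2 ⟨h, hxi.2⟩) fun y hy => ?_
      by_cases hy0 : y = (0, n - r)
      · exact Or.inr (hy0 ▸ ⟨Nat.zero_le _, hxi.2.1⟩)
      · have hy1 := hC.one_le_fst h1 (Finset.mem_erase.2 ⟨hy0, hy⟩)
        have h2 := hcomp (y.1 - 1, y.2) (by
          rw [hC.mem_rotate h1]
          right
          rwa [Nat.sub_add_cancel hy1])
        simp only [Prod.le_def] at h2 ⊢
        omega

theorem IsMaxChain.chainLength_rotate (hr : r ≤ n - r) (hC : IsMaxChain n r C)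
    (h1 : (1, n - r) ∈ C) : chainLength C + r ≤ chainLength (rotate n r C) := by
  have hinj : Set.InjOn (fun x : ℕ × ℕ => (x.1 - 1, x.2)) (C.erase (0, n - r)) := by
    intro x hx y hy hxy
    have h2 := hC.one_le_fst h1 hx
    have h3 := hC.one_le_fst h1 hy
    simp only [Prod.mk.injEq] at hxy
    exact Prod.ext (by omega) hxy.2
  have hnot : (r, n) ∉ (C.erase (0, n - r)).image fun x => (x.1 - 1, x.2) := by
    rw [Finset.mem_image]
    rintro ⟨x, hx, hxy⟩
    have h2 := hC.one_le_fst h1 hx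
    have h3 := mem_inner.1 (hC.subset (Finset.mem_of_mem_erase hx))
    simp only [Prod.mk.injEq] at hxy
    omega
  rw [chainLength, chainLength, rotate, Finset.sum_insert hnot, Finset.sum_image hinj,
    ← Finset.sum_erase_add _ _ hC.bot_mem]
  have hsum : ∑ x ∈ C.erase (0, n - r), (1 + (x.2 - (x.1 - 1)))
      = ∑ x ∈ C.erase (0, n - r), (1 + (x.2 - x.1)) + (C.card - 1) := by
    rw [← Finset.card_erase_of_mem hC.bot_mem, Finset.card_eq_sum_ones, ← Finset.sum_add_distrib]
    refine Finset.sum_congr rfl fun x hx => ?_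
    have h2 := hC.one_le_fst h1 hx
    have h3 := mem_inner.1 (hC.subset (Finset.mem_of_mem_erase hx))
    omega
  have hcard := hC.lt_card
  simp only at *
  omega

theorem rotate_injective {C' : Finset (ℕ × ℕ)} (hC : IsMaxChain n r C) (h1 : (1, n - r) ∈ C)
    (hC' : IsMaxChain n r C') (h1' : (1, n - r) ∈ C') (h : rotate n r C = rotate n r C') :
    C = C' := by
  have key : ∀ {D D' : Finset (ℕ × ℕ)}, IsMaxChain n r D → (1, n - r) ∈ D → IsMaxChain n r D' →
      (1, n - r) ∈ D' → rotate n r D = rotate n r D' → D ⊆ D' := by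
    intro D D' hD hD1 hD' hD1' hDD x hx
    by_cases hx0 : x = (0, n - r)
    · exact hx0 ▸ hD'.bot_mem
    have h2 := hD.one_le_fst hD1 (Finset.mem_erase.2 ⟨hx0, hx⟩)
    have h3 : (x.1 - 1, x.2) ∈ rotate n r D' := by
      rw [← hDD, hD.mem_rotate hD1]
      right
      rwa [Nat.sub_add_cancel h2]
    rcases (hD'.mem_rotate hD1').1 h3 with h4 | h4
    · have h5 := mem_inner.1 (hD.subset hx)
      simp only [Prod.mk.injEq] at h4
      omega
    · rwa [Nat.sub_add_cancel h2] at h4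
  exact (key hC h1 hC' h1' h).antisymm (key hC' h1' hC h1 h.symm)

/-- The image of a chain under the order-reversing involution `(a, b) ↦ (n - b, n - a)`. -/
def dual (n : ℕ) (C : Finset (ℕ × ℕ)) : Finset (ℕ × ℕ) := C.image fun x => (n - x.2, n - x.1)

theorem mem_dual (hr : r ≤ n) (hC : C ⊆ inner n r) {x : ℕ × ℕ} (hx : x ∈ inner n r) :
    x ∈ dual n C ↔ (n - x.2, n - x.1) ∈ C := by
  have hxi := mem_inner.1 hx
  rw [dual, Finset.mem_image]
  constructor
  · rintro ⟨y, hy, rfl⟩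
    have hyi := mem_inner.1 (hC hy)
    convert hy using 1
    exact Prod.ext (by simp only; omega) (by simp only; omega)
  · intro h
    exact ⟨_, h, Prod.ext (by simp only; omega) (by simp only; omega)⟩

theorem dual_mem_inner (hr : r ≤ n) {x : ℕ × ℕ} (hx : x ∈ inner n r) :
    (n - x.2, n - x.1) ∈ inner n r := by
  rw [mem_inner] at hx ⊢
  simp only
  omega

theorem dual_subset (hr : r ≤ n) (hC : C ⊆ inner n r) : dual n C ⊆ inner n r := fun x hx => by
  obtain ⟨y, hy, rfl⟩ := Finset.mem_image.1 hx
  exact dual_mem_inner hr (hC hy)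

theorem dual_dual (hr : r ≤ n) (hC : C ⊆ inner n r) : dual n (dual n C) = C := by
  have hsub := dual_subset hr (dual_subset hr hC)
  have hback : ∀ x ∈ inner n r, x ∈ dual n (dual n C) ↔ x ∈ C := fun x hx => by
    rw [mem_dual hr (dual_subset hr hC) hx, mem_dual hr hC (dual_mem_inner hr hx)]
    have hxi := mem_inner.1 hx
    have : ((n - (n - x.1), n - (n - x.2)) : ℕ × ℕ) = x :=
      Prod.ext (by simp only; omega) (by simp only; omega)
    simp only [this]
  ext x
  exact ⟨fun hx => (hback x (hsub hx)).1 hx, fun hx => (hback x (hC hx)).2 hx⟩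

theorem IsMaxChain.dual (hr : r ≤ n) (hC : IsMaxChain n r C) : IsMaxChain n r (dual n C) := by
  refine ⟨dual_subset hr hC.subset, fun x hx y hy => ?_, fun x hx hcomp => ?_⟩
  · obtain ⟨x', hx', rfl⟩ := Finset.mem_image.1 hx
    obtain ⟨y', hy', rfl⟩ := Finset.mem_image.1 hy
    have := hC.total x' hx' y' hy'
    simp only [Prod.le_def] at this ⊢
    omega
  · rw [mem_dual hr hC.subset hx]
    refine hC.maximal _ (dual_mem_inner hr hx) fun y hy => ?_
    have h := hcomp _ (Finset.mem_image_of_mem _ hy)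
    have hxi := mem_inner.1 hx
    have hyi := mem_inner.1 (hC.subset hy)
    simp only [Prod.le_def] at h ⊢
    omega

theorem chainLength_dual (hr : r ≤ n) (hC : C ⊆ inner n r) :
    chainLength (dual n C) = chainLength C := by
  have hinj : Set.InjOn (fun x : ℕ × ℕ => (n - x.2, n - x.1)) C := by
    intro x hx y hy hxy
    have hxi := mem_inner.1 (hC hx)
    have hyi := mem_inner.1 (hC hy)
    simp only [Prod.mk.injEq] at hxy
    exact Prod.ext (by omega) (by omega)
  rw [chainLength, dual, Finset.sum_image hinj]
  refine Finset.sum_congr rfl fun x hx => ?_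
  have hxi := mem_inner.1 (hC hx)
  simp only
  omega

end Chains

/-! ### Triangulations containing the boundary of a trapezoid -/

section Trap

variable {m n r : ℕ}

theorem isNonCrossingSet_insert {s : Finset (Sym2 (Pt m n))} {e : Sym2 (Pt m n)}
    (hs : IsNonCrossingSet s) (he : IsEdge e) (h : ∀ f ∈ s, e ≠ f → NonCrossing e f) :
    IsNonCrossingSet (insert e s) := by
  constructor
  · intro f hf
    rcases Finset.mem_insert.1 hf with rfl | hf
    exacts [he, hs.1 f hf]
  · intro f hf g hg hfg
    rcases Finset.mem_insert.1 hf with hfe | hf' <;> rcases Finset.mem_insert.1 hg with hge | hg'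
    · exact absurd (hfe.trans hge.symm) hfg
    · exact hfe ▸ h g hg' (hfe ▸ hfg)
    · exact hge ▸ (h f hf' (hge ▸ hfg.symm)).symm
    · exact hs.2 f hf' g hg' hfg

theorem exists_triangulation {s : Finset (Sym2 (Pt m n))} (hs : IsNonCrossingSet s) :
    ∃ σ : Triangulation m n, s ⊆ σ.1 := by
  obtain ⟨t, hst, ht⟩ := (Set.toFinite {t | IsNonCrossingSet t}).exists_le_maximal hs
  exact ⟨⟨t, ht⟩, hst⟩

theorem Triangulation.mem_of_nonCrossing (σ : Triangulation m n) {e : Sym2 (Pt m n)}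
    (he : IsEdge e) (h : ∀ f ∈ σ.1, e ≠ f → NonCrossing e f) : e ∈ σ.1 :=
  σ.2.2 (isNonCrossingSet_insert σ.2.1 he h) (Finset.subset_insert _ _)
    (Finset.mem_insert_self _ _)

theorem maximal_of_forall_mem {s : Finset (Sym2 (Pt m n))} (hs : IsNonCrossingSet s)
    (h : ∀ e, IsEdge e → (∀ f ∈ s, e ≠ f → NonCrossing e f) → e ∈ s) :
    Maximal IsNonCrossingSet s :=
  ⟨hs, fun _ ht hst e he => h e (ht.1 e he) fun f hf hef => ht.2 e he f (hst hf) hef⟩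

/-- The two slanted sides and the unit segments of the upper side of the trapezoid with vertices
`(0, 0)`, `(0, r)`, `(1, n)`, `(1, n - r)`. The lower side is left out: it lies on the boundary of
the rectangle, where nothing can cross it. -/
def trapBoundary (m n r : ℕ) : Finset (Sym2 (Pt m n)) :=
  {strip m n (0, n - r), strip m n (r, n)} ∪ (Finset.Ico (n - r) n).image (hor m n 1)

/-- The triangulations in which the sides of the trapezoid are unions of edges. -/
noncomputable def trap (m n r : ℕ) : Finset (Triangulation m n) :=
  Finset.univ.filter fun σ => trapBoundary m n r ⊆ σ.1

theorem mem_trap {σ : Triangulation m n} : σ ∈ trap m n r ↔ trapBoundary m n r ⊆ σ.1 := by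
  simp [trap]

theorem mem_trapBoundary {e : Sym2 (Pt m n)} : e ∈ trapBoundary m n r ↔
    e = strip m n (0, n - r) ∨ e = strip m n (r, n) ∨
      ∃ i, n - r ≤ i ∧ i < n ∧ hor m n 1 i = e := by
  simp [trapBoundary, and_assoc]

theorem left_mem_inner : (0, n - r) ∈ inner n r := mem_inner.2 (by simp)

theorem right_mem_inner : (r, n) ∈ inner n r := mem_inner.2 (by simp)

theorem fst_le_of_mem_inner (hr : r ≤ n) {x : ℕ × ℕ} (hx : x ∈ inner n r) : x.1 ≤ n :=
  (mem_inner.1 hx).1.trans hr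

theorem snd_le_of_mem_inner {x : ℕ × ℕ} (hx : x ∈ inner n r) : x.2 ≤ n := (mem_inner.1 hx).2.2

theorem strip_injOn_inner (hm : 1 ≤ m) (hr : r ≤ n) : Set.InjOn (strip m n) (inner n r) :=
  fun _ hx _ hy h => strip_injOn hm (fst_le_of_mem_inner hr hx) (snd_le_of_mem_inner hx)
    (fst_le_of_mem_inner hr hy) (snd_le_of_mem_inner hy) h

theorem hor_ne_strip (hm : 1 ≤ m) {h i : ℕ} (hh : h ≤ m) (x : ℕ × ℕ) :
    hor m n h i ≠ strip m n x := by
  intro h'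
  have h1 : pt m n 0 x.1 ∈ hor m n h i := by rw [h', strip]; simp
  have h2 : pt m n 1 x.2 ∈ hor m n h i := by rw [h', strip]; simp
  have key : ∀ p ∈ hor m n h i, (p.1 : ℕ) = h := fun p hp => by
    rcases Sym2.mem_iff.1 hp with rfl | rfl <;> exact pt_fst hh _
  have h3 := key _ h1
  have h4 := key _ h2
  rw [pt_fst (Nat.zero_le m)] at h3
  rw [pt_fst hm] at h4
  omega

/-- An edge other than a strip edge of the trapezoid that does not cross the sides of the trapezoid
does not cross any strip edge of the trapezoid: the trapezoid may be retriangulated freely. -/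
theorem nonCrossing_of_outside (hm : 1 ≤ m) (hr : r ≤ n) {e : Sym2 (Pt m n)} (he : IsEdge e)
    (hS : ∀ f ∈ trapBoundary m n r, e ≠ f → NonCrossing e f)
    (hout : ∀ x ∈ inner n r, e ≠ strip m n x) {x : ℕ × ℕ} (hx : x ∈ inner n r) :
    NonCrossing e (strip m n x) := by
  have key : ∀ p q : Pt m n, (p.1 : ℕ) ≤ q.1 → IsEdge s(p, q) →
      (∀ f ∈ trapBoundary m n r, s(p, q) ≠ f → NonCrossing s(p, q) f) →
      (∀ x ∈ inner n r, s(p, q) ≠ strip m n x) → NonCrossing s(p, q) (strip m n x) := by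
    intro p q hpq he hS hout
    have hxi := mem_inner.1 hx
    have hx1 := fst_le_of_mem_inner hr hx
    have hp2 : (p.2 : ℕ) ≤ n := Nat.lt_succ_iff.1 p.2.2
    have hq2 : (q.2 : ℕ) ≤ n := Nat.lt_succ_iff.1 q.2.2
    rcases Nat.eq_zero_or_pos (p.1 : ℕ) with hp | hp
    swap
    · exact nonCrossing_strip_of_one_le hm he hp (by omega) hx1 hxi.2.2
    rcases Nat.eq_zero_or_pos (q.1 : ℕ) with hq | hq
    · exact nonCrossing_strip_of_eq_zero hm he hp hq hx1 hxi.2.2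
    have hf := hS (strip m n (0, n - r)) (mem_trapBoundary.2 (Or.inl rfl))
      (hout _ left_mem_inner)
    rcases (Nat.succ_le_of_lt hq).eq_or_lt with hq1 | hq1
    · -- The edge is a strip edge outside of the trapezoid.
      have hg := hS (strip m n (r, n)) (mem_trapBoundary.2 (Or.inr (Or.inl rfl)))
        (hout _ right_mem_inner)
      have heq : s(p, q) = strip m n (p.2, q.2) := by
        rw [strip, ← eq_pt hp rfl, ← eq_pt hq1.symm rfl]
      have hne : ∀ y ∈ inner n r, ((p.2 : ℕ), (q.2 : ℕ)) ≠ y := fun y hy h =>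
        hout y hy (heq.trans (by rw [h]))
      rw [heq] at hf hg ⊢
      rw [nonCrossing_strip_strip hm hp2 hq2 (Nat.zero_le n) (Nat.sub_le n r)
        (hne _ left_mem_inner)] at hf
      rw [nonCrossing_strip_strip hm hp2 hq2 hr le_rfl (hne _ right_mem_inner)] at hg
      rw [nonCrossing_strip_strip hm hp2 hq2 hx1 hxi.2.2 (hne _ hx)]
      have h1 := hne _ hx
      have h2 : ((p.2 : ℕ), (q.2 : ℕ)) ∉ inner n r := fun h => hne _ h rfl
      rw [mem_inner] at h2
      simp only [Prod.le_def] at *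
      omega
    · -- The edge passes through height one to the left of the trapezoid.
      have hend : ∀ b ≤ n, (q.1 * b : ℤ) ≠ (q.1 - 1) * p.2 + q.2 := fun b hb h => by
        have h1 := he.pt_one_eq hm hp hq hb h
        rw [← h1, pt_fst hm] at hq1
        omega
      have hleft : (q.1 - 1 : ℤ) * p.2 + q.2 < q.1 * (n - r : ℕ) := by
        by_contra hcon
        rw [not_lt] at hcon
        obtain ⟨N, hN⟩ : ∃ N : ℕ, (N : ℤ) = (q.1 - 1 : ℤ) * p.2 + q.2 :=
          ⟨((q.1 : ℕ) - 1) * p.2 + q.2, by push_cast [Nat.cast_sub hq]; ring⟩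
        have hd1 : q.1 * (N / q.1) ≤ N := Nat.mul_div_le N q.1
        have hd2 : N < q.1 * (N / q.1 + 1) := Nat.lt_mul_div_succ N hq
        set i := N / (q.1 : ℕ) with hi
        have hin : n - r ≤ i := by
          rw [hi, Nat.le_div_iff_mul_le hq]
          rw [← hN] at hcon
          rw [mul_comm]
          exact_mod_cast hcon
        have hNle : N ≤ q.1 * n := by
          have h1 : (N : ℤ) ≤ q.1 * n := by
            rw [hN]
            have h2 : ((q.1 : ℕ) - 1 : ℤ) * (p.2 : ℕ) ≤ ((q.1 : ℕ) - 1 : ℤ) * n :=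
              mul_le_mul_of_nonneg_left (by exact_mod_cast hp2) (by omega)
            have h3 : ((q.2 : ℕ) : ℤ) ≤ n := by exact_mod_cast hq2
            linarith
          exact_mod_cast h1
        have hile : i ≤ n := by
          rw [hi]
          exact (Nat.div_le_div_right hNle).trans (Nat.mul_div_cancel_left n hq).le
        have hne1 := hend i hile
        have hne2 := hend n le_rfl
        rw [← hN] at hne1 hne2
        have hlt1 : (q.1 * i : ℤ) < N := lt_of_le_of_ne (by exact_mod_cast hd1) hne1
        have hlt2 : (N : ℤ) < q.1 * (i + 1) := by exact_mod_cast hd2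
        have hin' : i < n := by
          refine lt_of_le_of_ne hile fun h => ?_
          rw [h] at hlt1
          have : (N : ℤ) ≤ q.1 * n := by exact_mod_cast hNle
          omega
        refine not_between_of_nonCrossing_hor hm hp hq hin'
          (hS _ (mem_trapBoundary.2 (Or.inr (Or.inr ⟨i, hin, hin', rfl⟩))) fun h => ?_) ?_
        · have h1 : p ∈ hor m n 1 i := h ▸ Sym2.mem_mk_left p q
          rcases Sym2.mem_iff.1 h1 with h2 | h2 <;>
          · rw [h2, pt_fst hm] at hp
            omega
        · rw [← hN]
          exact ⟨hlt1, hlt2⟩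
      have hp0 : (p.2 : ℕ) = 0 := by
        by_contra hcon
        exact not_nonCrossing_strip hm hp hq (Nat.zero_le n) (Nat.sub_le n r)
          (Or.inr ⟨Nat.pos_of_ne_zero hcon, hleft⟩) hf
      refine nonCrossing_strip hm he hp hq hx1 hxi.2.2 (hout x hx) (Or.inl ⟨by omega, ?_⟩)
      refine hleft.le.trans (mul_le_mul_of_nonneg_left ?_ (by omega))
      exact_mod_cast hxi.2.1
  induction e with
  | _ p q =>
    rcases le_total (p.1 : ℕ) q.1 with h | h
    · exact key p q h he hS hout
    · rw [Sym2.eq_swap] at he hS hout ⊢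
      exact key q p h he hS hout

/-- The index set of the strip edges of the trapezoid that belong to `σ`. -/
noncomputable def chain (r : ℕ) (σ : Triangulation m n) : Finset (ℕ × ℕ) :=
  (inner n r).filter fun x => strip m n x ∈ σ.1

/-- The edges of `σ` that are not strip edges of the trapezoid. -/
noncomputable def outer (r : ℕ) (σ : Triangulation m n) : Finset (Sym2 (Pt m n)) :=
  σ.1.filter fun e => e ∉ (inner n r).image (strip m n)

theorem mem_outer {σ : Triangulation m n} {e : Sym2 (Pt m n)} :
    e ∈ outer r σ ↔ e ∈ σ.1 ∧ ∀ x ∈ inner n r, e ≠ strip m n x := by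
  simp [outer, eq_comm]

theorem outer_union_image_chain (σ : Triangulation m n) :
    outer r σ ∪ (chain r σ).image (strip m n) = σ.1 := by
  ext e
  simp only [Finset.mem_union, outer, chain, Finset.mem_filter, Finset.mem_image]
  constructor
  · rintro (h | ⟨x, hx, rfl⟩)
    exacts [h.1, hx.2]
  · intro h
    by_cases h1 : ∃ a ∈ inner n r, strip m n a = e
    · obtain ⟨x, hx, rfl⟩ := h1
      exact Or.inr ⟨x, ⟨hx, h⟩, rfl⟩
    · exact Or.inl ⟨h, h1⟩

theorem outer_nonCrossing (hm : 1 ≤ m) (hr : r ≤ n) {σ : Triangulation m n}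
    (hσ : σ ∈ trap m n r) {e : Sym2 (Pt m n)} (he : e ∈ outer r σ) {x : ℕ × ℕ}
    (hx : x ∈ inner n r) : NonCrossing e (strip m n x) := by
  rw [mem_outer] at he
  exact nonCrossing_of_outside hm hr (σ.2.1.1 e he.1)
    (fun f hf hef => σ.2.1.2 e he.1 f (mem_trap.1 hσ hf) hef) he.2 hx

theorem isMaxChain_chain (hm : 1 ≤ m) (hr : r ≤ n) {σ : Triangulation m n}
    (hσ : σ ∈ trap m n r) : IsMaxChain n r (chain r σ) := by
  refine ⟨Finset.filter_subset _ _, fun x hx y hy => ?_, fun x hx hcomp => ?_⟩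
  · rw [chain, Finset.mem_filter] at hx hy
    by_cases hxy : x = y
    · exact Or.inl hxy.le
    · have hne : strip m n x ≠ strip m n y :=
        fun h => hxy (strip_injOn_inner hm hr hx.1 hy.1 h)
      exact (nonCrossing_strip_strip hm (fst_le_of_mem_inner hr hx.1) (snd_le_of_mem_inner hx.1)
        (fst_le_of_mem_inner hr hy.1) (snd_le_of_mem_inner hy.1) hxy).1
        (σ.2.1.2 _ hx.2 _ hy.2 hne)
  · rw [chain, Finset.mem_filter]
    refine ⟨hx, σ.mem_of_nonCrossing
      (isEdge_strip hm (fst_le_of_mem_inner hr hx) (snd_le_of_mem_inner hx)) fun f hf hne => ?_⟩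
    rw [← outer_union_image_chain (r := r) σ, Finset.mem_union, Finset.mem_image] at hf
    rcases hf with hf | ⟨y, hy, rfl⟩
    · exact (outer_nonCrossing hm hr hσ hf hx).symm
    · have hy' := (Finset.mem_filter.1 hy).1
      exact (nonCrossing_strip_strip hm (fst_le_of_mem_inner hr hx) (snd_le_of_mem_inner hx)
        (fst_le_of_mem_inner hr hy') (snd_le_of_mem_inner hy')
        fun h => hne (by rw [h])).2 (hcomp y hy)

/-- Replacing the strip edges of the trapezoid by those of another maximal chain gives a
triangulation. -/
theorem exists_replace (hm : 1 ≤ m) (hr : r ≤ n) {σ : Triangulation m n} (hσ : σ ∈ trap m n r)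
    {C : Finset (ℕ × ℕ)} (hC : IsMaxChain n r C) :
    ∃ τ : Triangulation m n, τ ∈ trap m n r ∧ outer r τ = outer r σ ∧ chain r τ = C := by
  set s := outer r σ ∪ C.image (strip m n) with hs
  have hmem : ∀ e, e ∈ s ↔ e ∈ outer r σ ∨ ∃ x ∈ C, strip m n x = e := fun e => by
    rw [hs, Finset.mem_union, Finset.mem_image]
  have hstrip : ∀ x ∈ C, x.1 ≤ n ∧ x.2 ≤ n := fun x hx =>
    ⟨fst_le_of_mem_inner hr (hC.subset hx), snd_le_of_mem_inner (hC.subset hx)⟩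
  have hout : ∀ e ∈ s, (∀ x ∈ inner n r, e ≠ strip m n x) → e ∈ outer r σ := by
    intro e he h
    rcases (hmem e).1 he with h1 | ⟨x, hx, rfl⟩
    · exact h1
    · exact absurd rfl (h x (hC.subset hx))
  have hin : ∀ x ∈ inner n r, strip m n x ∈ s ↔ x ∈ C := by
    intro x hx
    rw [hmem]
    constructor
    · rintro (h1 | ⟨y, hy, hyx⟩)
      · exact absurd rfl ((mem_outer.1 h1).2 x hx)
      · rwa [← strip_injOn_inner hm hr (hC.subset hy) hx hyx]
    · exact fun h => Or.inr ⟨x, h, rfl⟩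
  have hS : trapBoundary m n r ⊆ s := by
    intro e he
    have h := mem_trap.1 hσ he
    rcases mem_trapBoundary.1 he with rfl | rfl | ⟨i, -, -, rfl⟩
    · exact (hin _ left_mem_inner).2 hC.bot_mem
    · exact (hin _ right_mem_inner).2 hC.top_mem
    · exact (hmem _).2 (Or.inl (mem_outer.2 ⟨h, fun x _ => hor_ne_strip hm hm x⟩))
  have hnc : IsNonCrossingSet s := by
    constructor
    · intro e he
      rcases (hmem e).1 he with h | ⟨x, hx, rfl⟩
      · exact σ.2.1.1 e (mem_outer.1 h).1
      · exact isEdge_strip hm (hstrip x hx).1 (hstrip x hx).2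
    · intro e he f hf hef
      rcases (hmem e).1 he with h | ⟨x, hx, rfl⟩ <;> rcases (hmem f).1 hf with h' | ⟨y, hy, rfl⟩
      · exact σ.2.1.2 e (mem_outer.1 h).1 f (mem_outer.1 h').1 hef
      · exact outer_nonCrossing hm hr hσ h (hC.subset hy)
      · exact (outer_nonCrossing hm hr hσ h' (hC.subset hx)).symm
      · exact (nonCrossing_strip_strip hm (hstrip x hx).1 (hstrip x hx).2 (hstrip y hy).1
          (hstrip y hy).2 fun h => hef (by rw [h])).2 (hC.total x hx y hy)
  have hmax : Maximal IsNonCrossingSet s := by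
    refine maximal_of_forall_mem hnc fun e he hes => ?_
    by_cases h : ∃ x ∈ inner n r, e = strip m n x
    · obtain ⟨x, hx, rfl⟩ := h
      refine (hin x hx).2 (hC.maximal x hx fun y hy => ?_)
      by_cases hxy : x = y
      · exact Or.inl hxy.le
      · exact (nonCrossing_strip_strip hm (fst_le_of_mem_inner hr hx) (snd_le_of_mem_inner hx)
          (hstrip y hy).1 (hstrip y hy).2 hxy).1 (hes _ ((hmem _).2 (Or.inr ⟨y, hy, rfl⟩))
            fun h => hxy (strip_injOn_inner hm hr hx (hC.subset hy) h))
    · push Not at h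
      refine (hmem e).2 (Or.inl (mem_outer.2 ⟨σ.mem_of_nonCrossing he fun f hf hef => ?_, h⟩))
      rw [← outer_union_image_chain (r := r) σ, Finset.mem_union, Finset.mem_image] at hf
      rcases hf with hf | ⟨y, hy, rfl⟩
      · exact hes f ((hmem f).2 (Or.inl hf)) hef
      · exact nonCrossing_of_outside hm hr he (fun f hf hef => hes f (hS hf) hef) h
          (Finset.mem_filter.1 hy).1
  refine ⟨⟨s, hmax⟩, mem_trap.2 hS, ?_, ?_⟩
  · ext e
    rw [mem_outer]
    exact ⟨fun h => hout e h.1 h.2, fun h => ⟨(hmem e).2 (Or.inl h), (mem_outer.1 h).2⟩⟩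
  · ext x
    rw [chain, Finset.mem_filter]
    exact ⟨fun h => (hin x h.1).1 h.2, fun h => ⟨hC.subset h, (hin x (hC.subset h)).2 h⟩⟩

theorem totalLength_eq (hm : 1 ≤ m) (hr : r ≤ n - r) (σ : Triangulation m n) :
    totalLength σ = ∑ e ∈ outer r σ, edgeLength e + chainLength (chain r σ) := by
  have hrn : r ≤ n := hr.trans (Nat.sub_le n r)
  have hdisj : Disjoint (outer r σ) ((chain r σ).image (strip m n)) := by
    rw [Finset.disjoint_left]
    intro e he he'
    obtain ⟨x, hx, rfl⟩ := Finset.mem_image.1 he'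
    exact (mem_outer.1 he).2 x (Finset.mem_filter.1 hx).1 rfl
  have hinj : Set.InjOn (strip m n) (chain r σ) := fun x hx y hy =>
    strip_injOn_inner hm hrn (Finset.mem_filter.1 hx).1 (Finset.mem_filter.1 hy).1
  rw [totalLength, ← outer_union_image_chain (r := r) σ, Finset.sum_union hdisj,
    Finset.sum_image hinj]
  congr 1
  refine Finset.sum_congr rfl fun x hx => ?_
  have hxi := mem_inner.1 (Finset.mem_filter.1 hx).1
  exact edgeLength_strip hm (by omega) hxi.2.2

/-- An injective operation on maximal chains that lengthens by `r` the chains with a property `p`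
shows that `p` has conditional weight at most `lam ^ (-r)` in the trap. -/
theorem sum_trap_filter_le {lam : ℝ} (hlam : 1 < lam) (hm : 1 ≤ m) (hr : r ≤ n - r)
    (p : Finset (ℕ × ℕ) → Prop) [DecidablePred p] (T : Finset (ℕ × ℕ) → Finset (ℕ × ℕ))
    (hT : ∀ C, IsMaxChain n r C → p C → IsMaxChain n r (T C))
    (hlen : ∀ C, IsMaxChain n r C → p C → chainLength C + r ≤ chainLength (T C))
    (hinj : ∀ C C', IsMaxChain n r C → p C → IsMaxChain n r C' → p C' → T C = T C' → C = C') :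
    lam ^ r * ∑ σ ∈ (trap m n r).filter (fun σ => p (chain r σ)), lam ^ totalLength σ ≤
      ∑ σ ∈ trap m n r, lam ^ totalLength σ := by
  have hrn : r ≤ n := hr.trans (Nat.sub_le n r)
  have hex : ∀ σ ∈ (trap m n r).filter (fun σ => p (chain r σ)), ∃ τ : Triangulation m n,
      τ ∈ trap m n r ∧ outer r τ = outer r σ ∧ chain r τ = T (chain r σ) := fun σ hσ => by
    rw [Finset.mem_filter] at hσ
    exact exists_replace hm hrn hσ.1 (hT _ (isMaxChain_chain hm hrn hσ.1) hσ.2)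
  choose! F hF1 hF2 hF3 using hex
  have hFinj : Set.InjOn F ((trap m n r).filter fun σ => p (chain r σ)) := by
    intro σ hσ τ hτ h
    have h1 : outer r σ = outer r τ := by rw [← hF2 σ hσ, h, hF2 τ hτ]
    have h2 : T (chain r σ) = T (chain r τ) := by rw [← hF3 σ hσ, h, hF3 τ hτ]
    have hσ' := Finset.mem_filter.1 hσ
    have hτ' := Finset.mem_filter.1 hτ
    have h3 := hinj _ _ (isMaxChain_chain hm hrn hσ'.1) hσ'.2 (isMaxChain_chain hm hrn hτ'.1)
      hτ'.2 h2
    apply Subtype.ext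
    rw [← outer_union_image_chain (r := r) σ, ← outer_union_image_chain (r := r) τ, h1, h3]
  rw [Finset.mul_sum]
  calc ∑ σ ∈ (trap m n r).filter (fun σ => p (chain r σ)), lam ^ r * lam ^ totalLength σ
      ≤ ∑ σ ∈ (trap m n r).filter (fun σ => p (chain r σ)), lam ^ totalLength (F σ) := by
        refine Finset.sum_le_sum fun σ hσ => ?_
        rw [← pow_add]
        refine pow_le_pow_right₀ hlam.le ?_
        have hσ' := Finset.mem_filter.1 hσ
        have h := hlen _ (isMaxChain_chain hm hrn hσ'.1) hσ'.2
        rw [totalLength_eq hm hr, totalLength_eq hm hr (F σ), hF2 σ hσ, hF3 σ hσ]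
        omega
    _ = ∑ σ ∈ ((trap m n r).filter fun σ => p (chain r σ)).image F, lam ^ totalLength σ :=
        (Finset.sum_image (f := fun σ => lam ^ totalLength σ) hFinj).symm
    _ ≤ ∑ σ ∈ trap m n r, lam ^ totalLength σ := by
        refine Finset.sum_le_sum_of_subset_of_nonneg (fun τ hτ => ?_) fun _ _ _ => by positivity
        obtain ⟨σ, hσ, rfl⟩ := Finset.mem_image.1 hτ
        exact hF1 σ hσ

theorem sum_trap_left_le {lam : ℝ} (hlam : 1 < lam) (hm : 1 ≤ m) (hr : r ≤ n - r) :
    lam ^ r * ∑ σ ∈ (trap m n r).filter (fun σ => (1, n - r) ∈ chain r σ), lam ^ totalLength σ ≤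
      ∑ σ ∈ trap m n r, lam ^ totalLength σ :=
  sum_trap_filter_le hlam hm hr (fun C => (1, n - r) ∈ C) (rotate n r)
    (fun _ hC h => hC.isMaxChain_rotate h) (fun _ hC h => hC.chainLength_rotate hr h)
    fun _ _ hC h hC' h' => rotate_injective hC h hC' h'

theorem sum_trap_right_le {lam : ℝ} (hlam : 1 < lam) (hm : 1 ≤ m) (hr : r ≤ n - r) (hr1 : 1 ≤ r) :
    lam ^ r * ∑ σ ∈ (trap m n r).filter (fun σ => (r, n - 1) ∈ chain r σ), lam ^ totalLength σ ≤
      ∑ σ ∈ trap m n r, lam ^ totalLength σ := by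
  have hrn : r ≤ n := hr.trans (Nat.sub_le n r)
  have hmem : ∀ C, IsMaxChain n r C → (r, n - 1) ∈ C → (1, n - r) ∈ dual n C := fun C hC h => by
    refine (mem_dual hrn hC.subset (mem_inner.2 (by simp only; omega))).2 ?_
    rwa [Nat.sub_sub_self hrn]
  refine sum_trap_filter_le hlam hm hr (fun C => (r, n - 1) ∈ C)
    (fun C => dual n (rotate n r (dual n C)))
    (fun C hC h => ((hC.dual hrn).isMaxChain_rotate (hmem C hC h)).dual hrn)
    (fun C hC h => ?_) fun C C' hC h hC' h' heq => ?_
  · have h1 := (hC.dual hrn).chainLength_rotate hr (hmem C hC h)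
    rwa [chainLength_dual hrn hC.subset, ← chainLength_dual hrn
      ((hC.dual hrn).isMaxChain_rotate (hmem C hC h)).subset] at h1
  · have h1 := congrArg (dual n) heq
    rw [dual_dual hrn ((hC.dual hrn).isMaxChain_rotate (hmem C hC h)).subset,
      dual_dual hrn ((hC'.dual hrn).isMaxChain_rotate (hmem C' hC' h')).subset] at h1
    have h2 := rotate_injective (hC.dual hrn) (hmem C hC h) (hC'.dual hrn) (hmem C' hC' h') h1
    rw [← dual_dual hrn hC.subset, h2, dual_dual hrn hC'.subset]

theorem trap_nonempty (hm : 1 ≤ m) (hr : r ≤ n) : (trap m n r).Nonempty := by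
  have hnc : IsNonCrossingSet (trapBoundary m n r) := by
    have hstr : ∀ x ∈ inner n r, IsEdge (strip m n x) := fun x hx =>
      isEdge_strip hm (fst_le_of_mem_inner hr hx) (snd_le_of_mem_inner hx)
    have hh : ∀ i < n, IsEdge (hor m n 1 i) := fun i hi => isEdge_hor hm hi
    have hhs : ∀ i < n, ∀ x ∈ inner n r, NonCrossing (hor m n 1 i) (strip m n x) :=
      fun i hi x hx => nonCrossing_strip_of_one_le hm (hh i hi) (pt_fst hm _).ge (pt_fst hm _).ge
        (fst_le_of_mem_inner hr hx) (snd_le_of_mem_inner hx)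
    have hss : ∀ x ∈ inner n r, ∀ y ∈ inner n r, x ≤ y ∨ y ≤ x →
        strip m n x ≠ strip m n y → NonCrossing (strip m n x) (strip m n y) :=
      fun x hx y hy hxy hne => (nonCrossing_strip_strip hm (fst_le_of_mem_inner hr hx)
        (snd_le_of_mem_inner hx) (fst_le_of_mem_inner hr hy) (snd_le_of_mem_inner hy)
        fun h => hne (by rw [h])).2 hxy
    have hlr : ((0, n - r) : ℕ × ℕ) ≤ (r, n) := ⟨Nat.zero_le r, Nat.sub_le n r⟩
    constructor
    · intro e he
      rcases mem_trapBoundary.1 he with rfl | rfl | ⟨i, -, hi, rfl⟩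
      exacts [hstr _ left_mem_inner, hstr _ right_mem_inner, hh i hi]
    · intro e he f hf hef
      rcases mem_trapBoundary.1 he with rfl | rfl | ⟨i, -, hi, rfl⟩ <;>
        rcases mem_trapBoundary.1 hf with rfl | rfl | ⟨i', -, hi', rfl⟩
      · exact absurd rfl hef
      · exact hss _ left_mem_inner _ right_mem_inner (Or.inl hlr) hef
      · exact (hhs i' hi' _ left_mem_inner).symm
      · exact hss _ right_mem_inner _ left_mem_inner (Or.inr hlr) hef
      · exact absurd rfl hef
      · exact (hhs i' hi' _ right_mem_inner).symm
      · exact hhs i hi _ left_mem_inner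
      · exact hhs i hi _ right_mem_inner
      · exact nonCrossing_hor_hor hm hi hm hi' fun h => hef (by rw [(Prod.mk.inj h).2])
  obtain ⟨σ, hσ⟩ := exists_triangulation hnc
  exact ⟨σ, mem_trap.2 hσ⟩

end Trap

/-! ### Flips -/

section Flips

variable {m n : ℕ}

theorem IsMidpoint.symm {x : ℕ × ℕ} {p q : Pt m n} (h : IsMidpoint x p q) : IsMidpoint x q p :=
  ⟨(add_comm _ _).trans h.1, (add_comm _ _).trans h.2⟩

theorem IsMidpoint.right_unique {x : ℕ × ℕ} {p q q' : Pt m n} (h : IsMidpoint x p q)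
    (h' : IsMidpoint x p q') : q = q' := by
  refine Prod.ext (Fin.ext ?_) (Fin.ext ?_)
  · have h1 := h.1
    have h2 := h'.1
    omega
  · have h1 := h.2
    have h2 := h'.2
    omega

theorem IsMidpoint.mem_seg {x : ℕ × ℕ} {p q : Pt m n} (h : IsMidpoint x p q) :
    (((x.1 : ℝ) / 2, (x.2 : ℝ) / 2) : ℝ × ℝ) ∈ seg s(p, q) := by
  rw [LatticeTriangulation.mem_seg, ← h.1, ← h.2]
  exact ⟨1 / 2, by norm_num, by norm_num, by push_cast; ring, by push_cast; ring⟩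

theorem IsEdge.ne {p q : Pt m n} (h : IsEdge s(p, q)) : p ≠ q := fun h' =>
  h.1 (Sym2.mk_isDiag_iff.2 h')

/-- A triangulation has at most one edge with a given midpoint. -/
theorem Triangulation.eq_of_isMidpoint (σ : Triangulation m n) {x : ℕ × ℕ} {a b c d : Pt m n}
    (hac : IsMidpoint x a c) (hbd : IsMidpoint x b d) (h1 : s(a, c) ∈ σ.1) (h2 : s(b, d) ∈ σ.1) :
    s(a, c) = s(b, d) := by
  by_contra hne
  obtain ⟨p, ⟨hp, -⟩, hpos⟩ := σ.2.1.2 _ h1 _ h2 hne ⟨hac.mem_seg, hbd.mem_seg⟩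
  have hne' := (σ.2.1.1 _ h1).ne
  have e1 := congrArg Prod.fst hpos
  have e2 := congrArg Prod.snd hpos
  simp only [pos] at e1 e2
  have e1' : 2 * (p.1 : ℕ) = x.1 := by
    have : (2 : ℝ) * (p.1 : ℕ) = x.1 := by linarith
    exact_mod_cast this
  have e2' : 2 * (p.2 : ℕ) = x.2 := by
    have : (2 : ℝ) * (p.2 : ℕ) = x.2 := by linarith
    exact_mod_cast this
  have h3 := hac.1
  have h4 := hac.2
  apply hne'
  rcases Sym2.mem_iff.1 hp with rfl | rfl
  · exact Prod.ext (Fin.ext (by omega)) (Fin.ext (by omega))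
  · exact Prod.ext (Fin.ext (by omega)) (Fin.ext (by omega))

theorem IsFlipAt.ne {x : ℕ × ℕ} {σ τ : Triangulation m n} (h : IsFlipAt x σ τ) : τ ≠ σ := by
  rintro rfl
  obtain ⟨a, b, c, d, hac, hbd, h1, hab, hbc, -, -, h2⟩ := h
  have h3 : s(b, d) ∈ τ.1 := by rw [h2]; exact Finset.mem_insert_self _ _
  rcases Sym2.eq_iff.1 (τ.eq_of_isMidpoint hac hbd h1 h3) with ⟨h4, -⟩ | ⟨-, h4⟩
  · exact (τ.2.1.1 _ hab).ne h4
  · exact (τ.2.1.1 _ hbc).ne h4.symm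

theorem IsFlipAt.symm {x : ℕ × ℕ} {σ τ : Triangulation m n} (h : IsFlipAt x σ τ) :
    IsFlipAt x τ σ := by
  obtain ⟨a, b, c, d, hac, hbd, h1, hab, hbc, hcd, hda, h2⟩ := h
  have nab := (σ.2.1.1 _ hab).ne
  have nbc := (σ.2.1.1 _ hbc).ne
  have ncd := (σ.2.1.1 _ hcd).ne
  have nda := (σ.2.1.1 _ hda).ne
  have hnot : s(b, d) ∉ σ.1 := fun h3 => by
    rcases Sym2.eq_iff.1 (σ.eq_of_isMidpoint hac hbd h1 h3) with ⟨h4, -⟩ | ⟨-, h4⟩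
    exacts [nab h4, nbc h4.symm]
  have hkeep : ∀ e ∈ σ.1, e ≠ s(a, c) → e ∈ τ.1 := fun e he hne => by
    rw [h2]
    exact Finset.mem_insert_of_mem (Finset.mem_erase.2 ⟨hne, he⟩)
  refine ⟨b, c, d, a, hbd, hac.symm, by rw [h2]; exact Finset.mem_insert_self _ _,
    hkeep _ hbc ?_, hkeep _ hcd ?_, hkeep _ hda ?_, hkeep _ hab ?_, ?_⟩
  · intro h; rcases Sym2.eq_iff.1 h with ⟨h3, -⟩ | ⟨h3, -⟩
    exacts [nab h3.symm, nbc h3]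
  · intro h; rcases Sym2.eq_iff.1 h with ⟨-, h3⟩ | ⟨-, h3⟩
    exacts [ncd h3.symm, nda h3]
  · intro h; rcases Sym2.eq_iff.1 h with ⟨h3, -⟩ | ⟨h3, -⟩
    exacts [nda h3, ncd h3.symm]
  · intro h; rcases Sym2.eq_iff.1 h with ⟨-, h3⟩ | ⟨-, h3⟩
    exacts [nbc h3, nab h3.symm]
  · rw [h2, Finset.erase_insert, Sym2.eq_swap (a := c), Finset.insert_erase h1]
    exact fun h => hnot (Finset.mem_of_mem_erase h)

/-- A flip changes only edges with the given midpoint. -/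
theorem IsFlipAt.eq_of_mem_iff_not {x y : ℕ × ℕ} {σ τ : Triangulation m n} (h : IsFlipAt x σ τ)
    {p q : Pt m n} (hy : IsMidpoint y p q) (hpq : ¬ (s(p, q) ∈ σ.1 ↔ s(p, q) ∈ τ.1)) :
    x = y := by
  obtain ⟨a, b, c, d, hac, hbd, -, -, -, -, -, h2⟩ := h
  have key : ∀ a c : Pt m n, IsMidpoint x a c → s(p, q) = s(a, c) → x = y := by
    intro a c hac h
    rcases Sym2.eq_iff.1 h with ⟨rfl, rfl⟩ | ⟨rfl, rfl⟩
    · exact Prod.ext (hac.1.symm.trans hy.1) (hac.2.symm.trans hy.2)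
    · exact Prod.ext (hac.symm.1.symm.trans hy.1) (hac.symm.2.symm.trans hy.2)
  by_cases h3 : s(p, q) = s(a, c)
  · exact key _ _ hac h3
  · by_cases h4 : s(p, q) = s(b, d)
    · exact key _ _ hbd h4
    · exact absurd (by rw [h2]; simp [h3, h4]) hpq

/-- If two segments `ac` and `bd` with a common midpoint `x` are edges, then `x`, `a`, `b` are not
collinear. -/
theorem det_ne_zero {x : ℕ × ℕ} {a b c d : Pt m n} (hac : IsMidpoint x a c)
    (hbd : IsMidpoint x b d) (eac : IsEdge s(a, c)) (ebd : IsEdge s(b, d)) (hab : a ≠ b)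
    (hbc : b ≠ c) (hda : d ≠ a) :
    (((a.1 : ℕ) : ℝ) - x.1 / 2) * ((b.2 : ℕ) - x.2 / 2) -
      ((a.2 : ℕ) - x.2 / 2) * ((b.1 : ℕ) - x.1 / 2) ≠ 0 := by
  intro hdet
  have hx1 : (x.1 : ℝ) = (a.1 : ℕ) + (c.1 : ℕ) := by exact_mod_cast hac.1.symm
  have hx2 : (x.2 : ℝ) = (a.2 : ℕ) + (c.2 : ℕ) := by exact_mod_cast hac.2.symm
  have hx3 : (x.1 : ℝ) = (b.1 : ℕ) + (d.1 : ℕ) := by exact_mod_cast hbd.1.symm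
  have hx4 : (x.2 : ℝ) = (b.2 : ℕ) + (d.2 : ℕ) := by exact_mod_cast hbd.2.symm
  -- A point `x + t (a - x)` with `|t| ≤ 1` lies on the segment `ac`.
  have hon : ∀ {a c : Pt m n}, (x.1 : ℝ) = (a.1 : ℕ) + (c.1 : ℕ) →
      (x.2 : ℝ) = (a.2 : ℕ) + (c.2 : ℕ) → ∀ (b : Pt m n) (t : ℝ), |t| ≤ 1 →
      ((b.1 : ℕ) : ℝ) - x.1 / 2 = t * ((a.1 : ℕ) - x.1 / 2) →
      ((b.2 : ℕ) : ℝ) - x.2 / 2 = t * ((a.2 : ℕ) - x.2 / 2) → pos b ∈ seg s(a, c) := by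
    intro a c h1 h2 b t ht e1 e2
    rw [abs_le] at ht
    rw [mem_seg]
    refine ⟨(1 - t) / 2, by linarith, by linarith, ?_, ?_⟩
    · simp only [pos]
      rw [h1] at e1
      linear_combination e1
    · simp only [pos]
      rw [h2] at e2
      linear_combination e2
  have hnot1 : ∀ t : ℝ, |t| ≤ 1 → ((b.1 : ℕ) : ℝ) - x.1 / 2 = t * ((a.1 : ℕ) - x.1 / 2) →
      ((b.2 : ℕ) : ℝ) - x.2 / 2 = t * ((a.2 : ℕ) - x.2 / 2) → False := fun t ht e1 e2 => by
    rcases Sym2.mem_iff.1 (eac.2 _ (hon hx1 hx2 b t ht e1 e2)) with h | h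
    exacts [hab h.symm, hbc h]
  have hnot2 : ∀ t : ℝ, |t| ≤ 1 → ((a.1 : ℕ) : ℝ) - x.1 / 2 = t * ((b.1 : ℕ) - x.1 / 2) →
      ((a.2 : ℕ) : ℝ) - x.2 / 2 = t * ((b.2 : ℕ) - x.2 / 2) → False := fun t ht e1 e2 => by
    rcases Sym2.mem_iff.1 (ebd.2 _ (hon hx3 hx4 a t ht e1 e2)) with h | h
    exacts [hab h, hda h.symm]
  set u1 := ((a.1 : ℕ) : ℝ) - x.1 / 2
  set u2 := ((a.2 : ℕ) : ℝ) - x.2 / 2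
  set v1 := ((b.1 : ℕ) : ℝ) - x.1 / 2
  set v2 := ((b.2 : ℕ) : ℝ) - x.2 / 2
  obtain ⟨s, e1, e2⟩ : ∃ s : ℝ, v1 = s * u1 ∧ v2 = s * u2 := by
    by_cases h1 : u1 = 0
    · by_cases h2 : u2 = 0
      · exact (hnot2 0 (by simp) (by rw [h1, zero_mul]) (by rw [h2, zero_mul])).elim
      · refine ⟨v2 / u2, ?_, by field_simp⟩
        rw [h1, zero_mul, zero_sub, neg_eq_zero] at hdet
        rw [h1, mul_zero]
        exact (mul_eq_zero.1 hdet).resolve_left h2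
    · refine ⟨v1 / u1, by field_simp, ?_⟩
      field_simp
      linarith
  rcases le_or_gt |s| 1 with hs | hs
  · exact hnot1 s hs e1 e2
  · have hs0 : s ≠ 0 := fun h => by rw [h, abs_zero] at hs; linarith
    refine hnot2 s⁻¹ (by rw [abs_inv]; exact inv_le_one_of_one_le₀ hs.le) ?_ ?_
    · rw [e1]; field_simp
    · rw [e2]; field_simp

/-- If the ray from the common midpoint `x` through `b` leaves the triangle `x`, `a`, `b'` through
the side `ab'`, and `bd` does not cross that side, then `b'` is an endpoint of `bd`. -/
theorem eq_or_eq_of_nonCrossing_side {x : ℕ × ℕ} {a b d b' : Pt m n} (hbd : IsMidpoint x b d)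
    (hnc : NonCrossing s(a, b') s(b, d)) (hab : a ≠ b) (hda : d ≠ a) {α β : ℝ} (hα : 0 ≤ α)
    (hβ : 0 ≤ β) (hαβ : 1 ≤ α + β)
    (e1 : ((b.1 : ℕ) : ℝ) - x.1 / 2 = α * ((a.1 : ℕ) - x.1 / 2) + β * ((b'.1 : ℕ) - x.1 / 2))
    (e2 : ((b.2 : ℕ) : ℝ) - x.2 / 2 = α * ((a.2 : ℕ) - x.2 / 2) + β * ((b'.2 : ℕ) - x.2 / 2)) :
    b' = b ∨ b' = d := by
  have hx3 : (x.1 : ℝ) = (b.1 : ℕ) + (d.1 : ℕ) := by exact_mod_cast hbd.1.symm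
  have hx4 : (x.2 : ℝ) = (b.2 : ℕ) + (d.2 : ℕ) := by exact_mod_cast hbd.2.symm
  have hpos : 0 < α + β := by linarith
  obtain ⟨t, ht0, ht1, ht⟩ : ∃ t : ℝ, 0 ≤ t ∧ t ≤ 1 ∧ t * (α + β) = 1 :=
    ⟨1 / (α + β), by positivity, by rw [div_le_one hpos]; exact hαβ, by field_simp⟩
  have hz : (((x.1 : ℝ) / 2 + t * ((b.1 : ℕ) - x.1 / 2),
      (x.2 : ℝ) / 2 + t * ((b.2 : ℕ) - x.2 / 2)) : ℝ × ℝ) ∈ seg s(a, b') ∩ seg s(b, d) := by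
    constructor
    · rw [mem_seg]
      refine ⟨t * β, by positivity, ?_, ?_, ?_⟩
      · rw [← ht]
        exact mul_le_mul_of_nonneg_left (by linarith) ht0
      · simp only
        rw [e1]
        linear_combination (((a.1 : ℕ) : ℝ) - x.1 / 2) * ht
      · simp only
        rw [e2]
        linear_combination (((a.2 : ℕ) : ℝ) - x.2 / 2) * ht
    · rw [mem_seg]
      refine ⟨(1 - t) / 2, by linarith, by linarith, ?_, ?_⟩
      · simp only
        rw [hx3]
        ring
      · simp only
        rw [hx4]
        ring
  obtain ⟨p, ⟨hp1, hp2⟩, -⟩ := hnc hz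
  rcases Sym2.mem_iff.1 hp1 with rfl | rfl <;> rcases Sym2.mem_iff.1 hp2 with h | h
  exacts [absurd h hab, absurd h.symm hda, Or.inl h, Or.inr h]

/-- If `b` lies outside the open parallelogram `ab'cd'` centred at the midpoint of `bd`, and `bd`
crosses no side of it, then `b'` is an endpoint of `bd`. -/
theorem eq_or_eq_of_nonCrossing_sides {x : ℕ × ℕ} {a b c d b' d' : Pt m n}
    (hac : IsMidpoint x a c) (hbd : IsMidpoint x b d) (hbd' : IsMidpoint x b' d') (hab : a ≠ b)
    (hbc : b ≠ c) (hcd : c ≠ d) (hda : d ≠ a)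
    (hnc : ∀ p ∈ s(a, c), ∀ q ∈ s(b', d'), NonCrossing s(p, q) s(b, d)) {α β : ℝ}
    (hαβ : 1 ≤ |α| + |β|)
    (e1 : ((b.1 : ℕ) : ℝ) - x.1 / 2 = α * ((a.1 : ℕ) - x.1 / 2) + β * ((b'.1 : ℕ) - x.1 / 2))
    (e2 : ((b.2 : ℕ) : ℝ) - x.2 / 2 = α * ((a.2 : ℕ) - x.2 / 2) + β * ((b'.2 : ℕ) - x.2 / 2)) :
    s(b', d') = s(b, d) := by
  have hx1 : (x.1 : ℝ) = (a.1 : ℕ) + (c.1 : ℕ) := by exact_mod_cast hac.1.symm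
  have hx2 : (x.2 : ℝ) = (a.2 : ℕ) + (c.2 : ℕ) := by exact_mod_cast hac.2.symm
  have hx3 : (x.1 : ℝ) = (b'.1 : ℕ) + (d'.1 : ℕ) := by exact_mod_cast hbd'.1.symm
  have hx4 : (x.2 : ℝ) = (b'.2 : ℕ) + (d'.2 : ℕ) := by exact_mod_cast hbd'.2.symm
  have fin1 : b' = b ∨ b' = d → s(b', d') = s(b, d) := by
    rintro (rfl | rfl)
    · rw [hbd'.right_unique hbd]
    · rw [hbd'.right_unique hbd.symm, Sym2.eq_swap]
  have fin2 : d' = b ∨ d' = d → s(b', d') = s(b, d) := by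
    rintro (rfl | rfl)
    · rw [hbd'.symm.right_unique hbd, Sym2.eq_swap]
    · rw [hbd'.symm.right_unique hbd.symm]
  rcases le_total 0 α with hα | hα <;> rcases le_total 0 β with hβ | hβ
  · rw [abs_of_nonneg hα, abs_of_nonneg hβ] at hαβ
    exact fin1 (eq_or_eq_of_nonCrossing_side hbd (hnc a (by simp) b' (by simp)) hab hda hα hβ hαβ
      e1 e2)
  · rw [abs_of_nonneg hα, abs_of_nonpos hβ] at hαβ
    refine fin2 (eq_or_eq_of_nonCrossing_side hbd (hnc a (by simp) d' (by simp)) hab hda hα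
      (neg_nonneg.2 hβ) hαβ ?_ ?_)
    · linear_combination e1 - β * hx3
    · linear_combination e2 - β * hx4
  · rw [abs_of_nonpos hα, abs_of_nonneg hβ] at hαβ
    refine fin1 (eq_or_eq_of_nonCrossing_side hbd (hnc c (by simp) b' (by simp)) hbc.symm hcd.symm
      (neg_nonneg.2 hα) hβ hαβ ?_ ?_)
    · linear_combination e1 - α * hx1
    · linear_combination e2 - α * hx2
  · rw [abs_of_nonpos hα, abs_of_nonpos hβ] at hαβ
    refine fin2 (eq_or_eq_of_nonCrossing_side hbd (hnc c (by simp) d' (by simp)) hbc.symm hcd.symm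
      (neg_nonneg.2 hα) (neg_nonneg.2 hβ) hαβ ?_ ?_)
    · linear_combination e1 - α * hx1 - β * hx3
    · linear_combination e2 - α * hx2 - β * hx4

/-- At most one triangulation is obtained from `σ` by flipping the edge with midpoint `x`: of two
distinct parallelograms with diagonal `ac`, one has a side that crosses the second diagonal of the
other. -/
theorem IsFlipAt.unique {x : ℕ × ℕ} {σ ρ ρ' : Triangulation m n} (h : IsFlipAt x σ ρ)
    (h' : IsFlipAt x σ ρ') : ρ = ρ' := by
  obtain ⟨a, b, c, d, hac, hbd, h1, hab, hbc, hcd, hda, h2⟩ := h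
  obtain ⟨a', b', c', d', hac', hbd', h1', hab', hbc', hcd', hda', h2'⟩ := h'
  have heq := σ.eq_of_isMidpoint hac hac' h1 h1'
  have nab := (σ.2.1.1 _ hab).ne
  have nbc := (σ.2.1.1 _ hbc).ne
  have ncd := (σ.2.1.1 _ hcd).ne
  have nda := (σ.2.1.1 _ hda).ne
  have nab' := (σ.2.1.1 _ hab').ne
  have nbc' := (σ.2.1.1 _ hbc').ne
  have ncd' := (σ.2.1.1 _ hcd').ne
  have nda' := (σ.2.1.1 _ hda').ne
  have hs : ∀ p ∈ s(a, c), ∀ q ∈ s(b, d), s(p, q) ∈ σ.1 := by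
    intro p hp q hq
    rcases Sym2.mem_iff.1 hp with rfl | rfl <;> rcases Sym2.mem_iff.1 hq with rfl | rfl
    · exact hab
    · rwa [Sym2.eq_swap]
    · rwa [Sym2.eq_swap]
    · exact hcd
  have hs' : ∀ p ∈ s(a, c), ∀ q ∈ s(b', d'), s(p, q) ∈ σ.1 := by
    rw [heq]
    intro p hp q hq
    rcases Sym2.mem_iff.1 hp with rfl | rfl <;> rcases Sym2.mem_iff.1 hq with rfl | rfl
    · exact hab'
    · rwa [Sym2.eq_swap]
    · rwa [Sym2.eq_swap]
    · exact hcd'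
  have hn : ∀ p ∈ s(a, c), p ∉ s(b, d) := by
    intro p hp hq
    exact (σ.2.1.1 _ (hs p hp p hq)).ne rfl
  have hn' : ∀ p ∈ s(a, c), p ∉ s(b', d') := by
    intro p hp hq
    exact (σ.2.1.1 _ (hs' p hp p hq)).ne rfl
  have ma : a ∈ s(a, c) := Sym2.mem_mk_left a c
  have mc : c ∈ s(a, c) := Sym2.mem_mk_right a c
  have mb' : b' ∈ s(b', d') := Sym2.mem_mk_left b' d'
  have md' : d' ∈ s(b', d') := Sym2.mem_mk_right b' d'
  -- The sides of each parallelogram do not cross the second diagonal of the other.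
  have hnc : ∀ p ∈ s(a, c), ∀ q ∈ s(b', d'), NonCrossing s(p, q) s(b, d) := by
    intro p hp q hq
    refine ρ.2.1.2 _ ?_ _ (by rw [h2]; exact Finset.mem_insert_self _ _) fun h =>
      hn p hp (h ▸ Sym2.mem_mk_left p q)
    rw [h2]
    exact Finset.mem_insert_of_mem (Finset.mem_erase.2
      ⟨fun h => hn' q (h ▸ Sym2.mem_mk_right p q) hq, hs' p hp q hq⟩)
  have hnc' : ∀ p ∈ s(a, c), ∀ q ∈ s(b, d), NonCrossing s(p, q) s(b', d') := by
    intro p hp q hq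
    refine ρ'.2.1.2 _ ?_ _ (by rw [h2']; exact Finset.mem_insert_self _ _) fun h =>
      hn' p hp (h ▸ Sym2.mem_mk_left p q)
    rw [h2', ← heq]
    exact Finset.mem_insert_of_mem (Finset.mem_erase.2
      ⟨fun h => hn q (h ▸ Sym2.mem_mk_right p q) hq, hs p hp q hq⟩)
  have eac := σ.2.1.1 _ h1
  have ebd : IsEdge s(b, d) := ρ.2.1.1 _ (by rw [h2]; exact Finset.mem_insert_self _ _)
  have ebd' : IsEdge s(b', d') := ρ'.2.1.1 _ (by rw [h2']; exact Finset.mem_insert_self _ _)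
  have qab' : a ≠ b' := fun h => hn' a ma (h ▸ mb')
  have qbc' : b' ≠ c := fun h => hn' c mc (h ▸ mb')
  have qcd' : c ≠ d' := fun h => hn' c mc (h ▸ md')
  have qda' : d' ≠ a := fun h => hn' a ma (h ▸ md')
  have hdet := det_ne_zero hac hbd' eac ebd' qab' qbc' qda'
  have hdet2 := det_ne_zero hac hbd eac ebd nab nbc nda
  suffices hbb : s(b', d') = s(b, d) by
    apply Subtype.ext
    rw [h2, h2', heq, hbb]
  obtain ⟨α, β, e1, e2, hβ⟩ : ∃ α β : ℝ,
      ((b.1 : ℕ) : ℝ) - x.1 / 2 = α * ((a.1 : ℕ) - x.1 / 2) + β * ((b'.1 : ℕ) - x.1 / 2) ∧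
      ((b.2 : ℕ) : ℝ) - x.2 / 2 = α * ((a.2 : ℕ) - x.2 / 2) + β * ((b'.2 : ℕ) - x.2 / 2) ∧
      β ≠ 0 := by
    set u1 := ((a.1 : ℕ) : ℝ) - x.1 / 2
    set u2 := ((a.2 : ℕ) : ℝ) - x.2 / 2
    set v1 := ((b'.1 : ℕ) : ℝ) - x.1 / 2
    set v2 := ((b'.2 : ℕ) : ℝ) - x.2 / 2
    set w1 := ((b.1 : ℕ) : ℝ) - x.1 / 2
    set w2 := ((b.2 : ℕ) : ℝ) - x.2 / 2
    refine ⟨(w1 * v2 - w2 * v1) / (u1 * v2 - u2 * v1), (u1 * w2 - u2 * w1) / (u1 * v2 - u2 * v1),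
      ?_, ?_, div_ne_zero hdet2 hdet⟩
    · rw [div_mul_eq_mul_div, div_mul_eq_mul_div, ← add_div, eq_div_iff hdet]
      ring
    · rw [div_mul_eq_mul_div, div_mul_eq_mul_div, ← add_div, eq_div_iff hdet]
      ring
  rcases le_or_gt 1 (|α| + |β|) with hge | hlt
  · exact eq_or_eq_of_nonCrossing_sides hac hbd hbd' nab nbc ncd nda hnc hge e1 e2
  · -- Otherwise `b` lies inside the parallelogram `ab'cd'`, and then `b'` lies outside `abcd`.
    have hβ0 : 0 < |β| := abs_pos.2 hβ
    refine (eq_or_eq_of_nonCrossing_sides (α := -α / β) (β := 1 / β) hac hbd' hbd qab' qbc' qcd'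
      qda' hnc' ?_ ?_ ?_).symm
    · rw [abs_div, abs_div, abs_neg, abs_one, ← add_div, le_div_iff₀ hβ0]
      have := abs_nonneg α
      linarith
    · rw [e1]; field_simp; ring
    · rw [e2]; field_simp; ring

end Flips

/-! ### The Glauber dynamics -/

section Glauber

variable {m n : ℕ} {lam : ℝ}

theorem nonempty_triangulation : Nonempty (Triangulation m n) := by
  obtain ⟨σ, -⟩ := exists_triangulation (m := m) (n := n) (s := ∅) ⟨by simp, by simp⟩
  exact ⟨σ⟩

theorem partitionFunction_pos (hlam : 0 < lam) : 0 < partitionFunction lam m n := by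
  obtain ⟨σ⟩ := nonempty_triangulation (m := m) (n := n)
  exact Finset.sum_pos (fun _ _ => pow_pos hlam _) ⟨σ, Finset.mem_univ _⟩

theorem gibbs_pos (hlam : 0 < lam) (σ : Triangulation m n) : 0 < gibbs lam σ :=
  div_pos (pow_pos hlam _) (partitionFunction_pos hlam)

theorem sum_gibbs (hlam : 0 < lam) : ∑ σ : Triangulation m n, gibbs lam σ = 1 := by
  simp_rw [gibbs]
  rw [← Finset.sum_div]
  exact div_self (partitionFunction_pos hlam).ne'

theorem siteUpdate_nonneg (hlam : 0 < lam) (x : ℕ × ℕ) (σ τ : Triangulation m n) :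
    0 ≤ siteUpdate lam x σ τ := by
  have hterm : ∀ ρ : Triangulation m n, gibbs lam ρ / (gibbs lam ρ + gibbs lam σ) ≤ 1 := fun ρ => by
    have h1 := gibbs_pos hlam ρ
    have h2 := gibbs_pos hlam σ
    rw [div_le_one (by positivity)]
    linarith
  rw [siteUpdate]
  split_ifs with h1 h2
  · have h1 := gibbs_pos hlam τ
    have h2 := gibbs_pos hlam σ
    positivity
  · rw [sub_nonneg]
    by_cases h : ∃ ρ, IsFlipAt x σ ρ
    · obtain ⟨ρ, hρ⟩ := h
      rw [Finset.sum_eq_single ρ, if_pos hρ]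
      · exact hterm ρ
      · exact fun ρ' _ hne => if_neg fun h => hne (h.unique hρ)
      · exact fun h => absurd (Finset.mem_univ _) h
    · push Not at h
      rw [Finset.sum_eq_zero fun ρ _ => if_neg (h ρ)]
      exact zero_le_one
  · exact le_rfl

theorem sum_siteUpdate (x : ℕ × ℕ) (σ : Triangulation m n) :
    ∑ τ, siteUpdate lam x σ τ = 1 := by
  classical
  have hself : ¬ IsFlipAt x σ σ := fun h => h.ne rfl
  have h : ∀ τ, siteUpdate lam x σ τ =
      (if IsFlipAt x σ τ then gibbs lam τ / (gibbs lam τ + gibbs lam σ) else 0) +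
      if τ = σ then siteUpdate lam x σ σ else 0 := fun τ => by
    by_cases h1 : IsFlipAt x σ τ
    · rw [siteUpdate, if_pos h1, if_pos h1, if_neg h1.ne, add_zero]
    · by_cases h2 : τ = σ
      · rw [if_neg h1, if_pos h2, h2, zero_add]
      · rw [siteUpdate, if_neg h1, if_neg h1, if_neg h2, if_neg h2, add_zero]
  rw [Finset.sum_congr rfl fun τ _ => h τ, Finset.sum_add_distrib,
    Finset.sum_ite_eq' Finset.univ σ, if_pos (Finset.mem_univ _), siteUpdate, if_neg hself,
    if_pos rfl]
  convert add_sub_cancel _ _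

theorem gibbs_mul_siteUpdate (x : ℕ × ℕ) (σ τ : Triangulation m n) :
    gibbs lam σ * siteUpdate lam x σ τ = gibbs lam τ * siteUpdate lam x τ σ := by
  by_cases h : IsFlipAt x σ τ
  · rw [siteUpdate, siteUpdate, if_pos h, if_pos h.symm, add_comm (gibbs lam σ)]
    ring
  · by_cases h2 : τ = σ
    · rw [h2]
    · rw [siteUpdate, siteUpdate, if_neg h, if_neg h2, if_neg fun h' => h h'.symm,
        if_neg (Ne.symm h2), mul_zero, mul_zero]

theorem glauber_apply (σ τ : Triangulation m n) : glauber lam m n σ τ =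
    ((midpoints m n).card : ℝ)⁻¹ * ∑ x ∈ midpoints m n, siteUpdate lam x σ τ := rfl

theorem five_le_card_midpoints (hm : 1 ≤ m) (hn : 1 ≤ n) : 5 ≤ (midpoints m n).card := by
  -- the midpoints of the sides and of the diagonals of the unit square at the origin
  have h : ({(0, 1), (1, 0), (1, 1), (1, 2), (2, 1)} : Finset (ℕ × ℕ)) ⊆ midpoints m n := by
    intro x hx
    simp only [Finset.mem_insert, Finset.mem_singleton] at hx
    rw [midpoints, Finset.mem_filter, Finset.mem_product, Finset.mem_range, Finset.mem_range]
    rcases hx with rfl | rfl | rfl | rfl | rfl <;>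
      exact ⟨⟨by simp only; omega, by simp only; omega⟩, by decide⟩
  exact (Finset.card_le_card h).trans' (by decide)

theorem glauber_nonneg (hlam : 0 < lam) (σ τ : Triangulation m n) : 0 ≤ glauber lam m n σ τ :=
  mul_nonneg (by positivity) (Finset.sum_nonneg fun x _ => siteUpdate_nonneg hlam x σ τ)

theorem sum_glauber (hm : 1 ≤ m) (hn : 1 ≤ n) (σ : Triangulation m n) :
    ∑ τ, glauber lam m n σ τ = 1 := by
  have h := five_le_card_midpoints hm hn
  simp_rw [glauber_apply]
  rw [← Finset.mul_sum, Finset.sum_comm]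
  simp_rw [sum_siteUpdate]
  rw [Finset.sum_const, nsmul_eq_mul, mul_one, inv_mul_cancel₀]
  exact_mod_cast (by omega : (midpoints m n).card ≠ 0)

theorem gibbs_stationary (hm : 1 ≤ m) (hn : 1 ≤ n) (τ : Triangulation m n) :
    ∑ σ, gibbs lam σ * glauber lam m n σ τ = gibbs lam τ := by
  have h : ∀ σ, gibbs lam σ * glauber lam m n σ τ = gibbs lam τ * glauber lam m n τ σ := fun σ => by
    rw [glauber_apply, glauber_apply, mul_left_comm, mul_left_comm (gibbs lam τ),
      Finset.mul_sum _ _ (gibbs lam σ), Finset.mul_sum _ _ (gibbs lam τ)]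
    exact congrArg _ (Finset.sum_congr rfl fun x _ => gibbs_mul_siteUpdate x σ τ)
  simp_rw [h]
  rw [← Finset.mul_sum, sum_glauber hm hn, mul_one]

open Classical in
/-- In one step, the presence of a given edge changes with probability at most `1 / |Λ|`. -/
theorem sum_glauber_change_le (hlam : 0 < lam) (hm : 1 ≤ m) (hn : 1 ≤ n) (p q : Pt m n)
    (σ : Triangulation m n) :
    ∑ τ with ¬ (s(p, q) ∈ σ.1 ↔ s(p, q) ∈ τ.1), glauber lam m n σ τ ≤ 1 / 5 := by
  set y : ℕ × ℕ := ((p.1 : ℕ) + q.1, (p.2 : ℕ) + q.2) with hy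
  have hsite : ∀ x ∈ midpoints m n,
      ∑ τ with ¬ (s(p, q) ∈ σ.1 ↔ s(p, q) ∈ τ.1), siteUpdate lam x σ τ ≤
        if y = x then 1 else 0 := by
    intro x _
    split_ifs with hxy
    · rw [← sum_siteUpdate (lam := lam) x σ]
      exact Finset.sum_le_sum_of_subset_of_nonneg (Finset.subset_univ _) fun τ _ _ =>
        siteUpdate_nonneg hlam x σ τ
    · refine (Finset.sum_eq_zero fun τ hτ => ?_).le
      have hτ' := (Finset.mem_filter.1 hτ).2
      rw [siteUpdate, if_neg fun h => hxy (h.eq_of_mem_iff_not ⟨rfl, rfl⟩ hτ').symm, if_neg]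
      rintro rfl
      exact hτ' Iff.rfl
  have hcard : (5 : ℝ) ≤ (midpoints m n).card := by exact_mod_cast five_le_card_midpoints hm hn
  simp_rw [glauber_apply]
  rw [← Finset.mul_sum, Finset.sum_comm]
  calc ((midpoints m n).card : ℝ)⁻¹ * ∑ x ∈ midpoints m n,
        ∑ τ with ¬ (s(p, q) ∈ σ.1 ↔ s(p, q) ∈ τ.1), siteUpdate lam x σ τ
      ≤ ((midpoints m n).card : ℝ)⁻¹ * 1 := by
        refine mul_le_mul_of_nonneg_left ((Finset.sum_le_sum hsite).trans ?_) (by positivity)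
        rw [Finset.sum_ite_eq]
        split_ifs <;> norm_num
    _ ≤ 1 / 5 := by
        rw [mul_one, one_div]
        exact inv_anti₀ (by norm_num) hcard

end Glauber

/-! ### Leaving the trap -/

section Exit

variable {m n r : ℕ}

/-- An edge removed by a flip is a diagonal of a parallelogram with sides in `σ`; the other two
vertices are listed in the order of their heights. -/
theorem IsFlipAt.exists_parallelogram {x : ℕ × ℕ} {σ τ : Triangulation m n} (h : IsFlipAt x σ τ)
    {p q : Pt m n} (hσ : s(p, q) ∈ σ.1) (hτ : s(p, q) ∉ τ.1) :
    ∃ b d : Pt m n, (b.1 : ℕ) ≤ d.1 ∧ (b.1 : ℕ) + d.1 = p.1 + q.1 ∧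
      (b.2 : ℕ) + d.2 = p.2 + q.2 ∧ s(p, b) ∈ σ.1 ∧ s(b, q) ∈ σ.1 ∧ s(p, d) ∈ σ.1 ∧
      s(d, q) ∈ σ.1 := by
  obtain ⟨a, b, c, d, hac, hbd, -, hab, hbc, hcd, hda, h2⟩ := h
  have hpq : s(p, q) = s(a, c) := by
    by_contra hne
    exact hτ (by rw [h2]; exact Finset.mem_insert_of_mem (Finset.mem_erase.2 ⟨hne, hσ⟩))
  have key : ∀ a c : Pt m n, IsMidpoint x a c → s(a, b) ∈ σ.1 → s(b, c) ∈ σ.1 → s(c, d) ∈ σ.1 →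
      s(d, a) ∈ σ.1 → ∃ b d : Pt m n, (b.1 : ℕ) ≤ d.1 ∧ (b.1 : ℕ) + d.1 = a.1 + c.1 ∧
      (b.2 : ℕ) + d.2 = a.2 + c.2 ∧ s(a, b) ∈ σ.1 ∧ s(b, c) ∈ σ.1 ∧ s(a, d) ∈ σ.1 ∧
      s(d, c) ∈ σ.1 := by
    intro a c hac hab hbc hcd hda
    have e1 := hac.1.trans hbd.1.symm
    have e2 := hac.2.trans hbd.2.symm
    rw [Sym2.eq_swap] at hcd hda
    rcases le_total (b.1 : ℕ) d.1 with h | h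
    · exact ⟨b, d, h, e1.symm, e2.symm, hab, hbc, hda, hcd⟩
    · exact ⟨d, b, h, by omega, by omega, hda, hcd, hab, hbc⟩
  rcases Sym2.eq_iff.1 hpq with ⟨rfl, rfl⟩ | ⟨rfl, rfl⟩
  · exact key _ _ hac hab hbc hcd hda
  · rw [Sym2.eq_swap] at hab hbc hcd hda
    exact key _ _ hac.symm hbc hab hda hcd

/-- A flip that leaves the trap flips a slanted side of the trapezoid: the parallelogram around a
segment of the upper side would stick out of the rectangle, as `3 * r ≤ n`. The only parallelogram
around the left side that fits into the rectangle has `(0, 1)` as a vertex, and the only one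
around the right side has `(1, n - 1)` as a vertex. -/
theorem mem_chain_of_isFlipAt (hm : 1 ≤ m) (hr1 : 1 ≤ r) (hr : 3 * r ≤ n) {x : ℕ × ℕ}
    {σ τ : Triangulation m n} (h : IsFlipAt x σ τ) (hσ : σ ∈ trap m n r) (hτ : τ ∉ trap m n r) :
    (1, n - r) ∈ chain r σ ∨ (r, n - 1) ∈ chain r σ := by
  rw [mem_trap, Finset.not_subset] at hτ
  obtain ⟨e, he, heτ⟩ := hτ
  have heσ := mem_trap.1 hσ he
  have hg : strip m n (r, n) ∈ σ.1 := mem_trap.1 hσ (mem_trapBoundary.2 (Or.inr (Or.inl rfl)))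
  have hkn : n - r ≤ n := Nat.sub_le n r
  have hrn : r ≤ n := by omega
  rcases mem_trapBoundary.1 he with rfl | rfl | ⟨i, hi1, hi2, rfl⟩
  · left
    obtain ⟨b, d, hbd, h1, -, h3, h4, -, -⟩ := h.exists_parallelogram heσ heτ
    simp only [pt_fst (Nat.zero_le m), pt_fst hm] at h1
    have hb0 : (b.1 : ℕ) = 0 := by omega
    have e1 := σ.2.1.1 _ h3
    have hpos : 0 < (b.2 : ℕ) := by
      refine Nat.pos_of_ne_zero fun h5 => e1.ne ?_
      rw [eq_pt hb0 h5]
    have hb2 : (b.2 : ℕ) = 1 := by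
      have h5 := e1.snd_eq_succ (Fin.ext (by rw [hb0, pt_fst (Nat.zero_le m)]))
        (by rw [pt_snd _ (Nat.zero_le n)]; exact hpos)
      rwa [pt_snd _ (Nat.zero_le n)] at h5
    rw [eq_pt hb0 hb2] at h4
    exact Finset.mem_filter.2 ⟨mem_inner.2 ⟨hr1, le_rfl, hkn⟩, h4⟩
  · right
    obtain ⟨b, d, hbd, h1, -, -, -, h5, h6⟩ := h.exists_parallelogram heσ heτ
    simp only [pt_fst (Nat.zero_le m), pt_fst hm] at h1
    have hd1 : (d.1 : ℕ) = 1 := by omega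
    have hd2 := d.2.2
    have e1 := σ.2.1.1 _ h6
    have hlt : (d.2 : ℕ) < n := by
      refine lt_of_le_of_ne (by omega) fun h7 => e1.ne ?_
      rw [eq_pt hd1 h7]
    have h7 := e1.snd_eq_succ (Fin.ext (by rw [hd1, pt_fst hm]))
      (by rw [pt_snd _ le_rfl]; exact hlt)
    rw [pt_snd _ le_rfl] at h7
    rw [eq_pt hd1 (show (d.2 : ℕ) = n - 1 by omega)] at h5
    exact Finset.mem_filter.2 ⟨mem_inner.2 ⟨le_rfl, by simp only; omega, by simp only; omega⟩, h5⟩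
  · exfalso
    obtain ⟨b, d, hbd, h1, h2, h3, h4, -, -⟩ := h.exists_parallelogram heσ heτ
    simp only [pt_fst hm, pt_snd _ hi2.le, pt_snd _ (Nat.succ_le_of_lt hi2)] at h1 h2
    have hb2 := b.2.2
    have hd2 := d.2.2
    rcases (by omega : (b.1 : ℕ) = 0 ∨ (b.1 : ℕ) = 1) with hb | hb
    · have heq : strip m n (b.2, i) ∈ σ.1 := by
        rw [strip, ← eq_pt hb rfl, Sym2.eq_swap]
        exact h3
      have hne : ((b.2 : ℕ), i) ≠ (r, n) := fun h => by
        rw [Prod.mk.injEq] at h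
        omega
      have hcomp := (nonCrossing_strip_strip hm (x := (b.2, i)) (y := (r, n)) (by simp only; omega)
        hi2.le hrn le_rfl hne).1 (σ.2.1.2 _ heq _ hg fun h =>
          hne (strip_injOn hm (by simp only; omega) hi2.le hrn le_rfl h))
      simp only [Prod.mk_le_mk] at hcomp
      omega
    · -- The two adjacent points of a unit segment have no common neighbour on their line.
      have key : ∀ p q : Pt m n, s(p, q) ∈ σ.1 → p.1 = q.1 →
          (p.2 : ℕ) = q.2 + 1 ∨ (q.2 : ℕ) = p.2 + 1 := by
        intro p q hpq h1
        have e1 := σ.2.1.1 _ hpq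
        rcases lt_trichotomy (p.2 : ℕ) q.2 with h2 | h2 | h2
        · exact Or.inr (e1.snd_eq_succ h1 h2)
        · exact absurd (Prod.ext h1 (Fin.ext h2)) e1.ne
        · rw [Sym2.eq_swap] at e1
          exact Or.inl (e1.snd_eq_succ h1.symm h2)
      have h5 := key _ _ h3 (Fin.ext (by rw [pt_fst hm, hb]))
      have h6 := key _ _ h4 (Fin.ext (by rw [pt_fst hm, hb]))
      rw [pt_snd _ hi2.le] at h5
      rw [pt_snd _ (Nat.succ_le_of_lt hi2)] at h6
      omega

theorem sum_gibbs_eq_div (lam : ℝ) (s : Finset (Triangulation m n)) :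
    ∑ σ ∈ s, gibbs lam σ = (∑ σ ∈ s, lam ^ totalLength σ) / partitionFunction lam m n :=
  (Finset.sum_div _ _ _).symm

theorem escape_trap_le {lam : ℝ} (hlam : 1 < lam) (hm : 1 ≤ m) (hr1 : 1 ≤ r) (hr : 3 * r ≤ n) :
    ∑ σ ∈ trap m n r, gibbs lam σ * ∑ τ ∈ (trap m n r)ᶜ, glauber lam m n σ τ ≤
      2 / lam ^ r * ∑ σ ∈ trap m n r, gibbs lam σ := by
  have h0 : 0 < lam := by linarith
  have hn : 1 ≤ n := by omega
  have hle1 : ∀ σ : Triangulation m n, ∑ τ ∈ (trap m n r)ᶜ, glauber lam m n σ τ ≤ 1 := fun σ => by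
    rw [← sum_glauber (lam := lam) hm hn σ]
    exact Finset.sum_le_sum_of_subset_of_nonneg (Finset.subset_univ _) fun τ _ _ =>
      glauber_nonneg h0 σ τ
  have hterm : ∀ σ ∈ trap m n r,
      gibbs lam σ * ∑ τ ∈ (trap m n r)ᶜ, glauber lam m n σ τ ≤
        (if (1, n - r) ∈ chain r σ then gibbs lam σ else 0) +
        if (r, n - 1) ∈ chain r σ then gibbs lam σ else 0 := by
    intro σ hσ
    have hg := (gibbs_pos h0 σ).le
    have h1 := mul_le_of_le_one_right hg (hle1 σ)
    by_cases hl : (1, n - r) ∈ chain r σ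
    · rw [if_pos hl]
      split_ifs <;> linarith
    · by_cases hr' : (r, n - 1) ∈ chain r σ
      · rw [if_pos hr']
        split_ifs
        linarith
      · rw [if_neg hl, if_neg hr', add_zero, Finset.sum_eq_zero, mul_zero]
        intro τ hτ
        rw [Finset.mem_compl] at hτ
        rw [glauber_apply, Finset.sum_eq_zero, mul_zero]
        intro x _
        rw [siteUpdate, if_neg, if_neg]
        · rintro rfl
          exact hτ hσ
        · intro h
          rcases mem_chain_of_isFlipAt hm hr1 hr h hσ hτ with h2 | h2
          exacts [hl h2, hr' h2]
  refine (Finset.sum_le_sum hterm).trans ?_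
  rw [Finset.sum_add_distrib, ← Finset.sum_filter, ← Finset.sum_filter, sum_gibbs_eq_div,
    sum_gibbs_eq_div, sum_gibbs_eq_div, ← add_div, ← mul_div_assoc]
  have hZ := partitionFunction_pos (m := m) (n := n) h0
  refine div_le_div_of_nonneg_right ?_ hZ.le
  have h1 := sum_trap_left_le (n := n) (r := r) hlam hm (by omega)
  have h2 := sum_trap_right_le (n := n) (r := r) hlam hm (by omega) hr1
  have hpow : 0 < lam ^ r := pow_pos h0 r
  rw [div_mul_eq_mul_div, le_div_iff₀ hpow]
  linarith

end Exit

/-! ### Symmetries of the rectangle -/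

section Symmetry

/-- A bijection between the points of two rectangles that is induced by an injective affine map of
the plane and preserves the `ℓ¹` length of segments. -/
structure LatticeIso (m n m' n' : ℕ) where
  toEquiv : Pt m n ≃ Pt m' n'
  toAffineMap : (ℝ × ℝ) →ᵃ[ℝ] (ℝ × ℝ)
  injective : Function.Injective toAffineMap
  pos_apply : ∀ p, pos (toEquiv p) = toAffineMap (pos p)
  edgeLength_map : ∀ e : Sym2 (Pt m n), edgeLength (e.map toEquiv) = edgeLength e

variable {m n m' n' : ℕ} (φ : LatticeIso m n m' n')

/-- The induced bijection between segments. -/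
def LatticeIso.edge : Sym2 (Pt m n) ≃ Sym2 (Pt m' n') where
  toFun := Sym2.map φ.toEquiv
  invFun := Sym2.map φ.toEquiv.symm
  left_inv e := by simp [Sym2.map_map]
  right_inv e := by simp [Sym2.map_map]

theorem LatticeIso.edge_apply (e : Sym2 (Pt m n)) : φ.edge e = e.map φ.toEquiv := rfl

theorem LatticeIso.mem_edge {p : Pt m n} {e : Sym2 (Pt m n)} :
    φ.toEquiv p ∈ φ.edge e ↔ p ∈ e := by
  rw [φ.edge_apply, Sym2.mem_map]
  exact ⟨fun ⟨q, hq, h⟩ => φ.toEquiv.injective h ▸ hq, fun h => ⟨p, h, rfl⟩⟩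

theorem LatticeIso.seg_edge (e : Sym2 (Pt m n)) :
    seg (φ.edge e) = φ.toAffineMap '' seg e := by
  rw [seg, seg, AffineMap.image_convexHull]
  congr 1
  ext z
  simp only [Set.mem_image, Set.mem_ofPred_eq]
  constructor
  · rintro ⟨p, hp, rfl⟩
    obtain ⟨q, rfl⟩ := φ.toEquiv.surjective p
    exact ⟨pos q, ⟨q, φ.mem_edge.1 hp, rfl⟩, (φ.pos_apply q).symm⟩
  · rintro ⟨_, ⟨q, hq, rfl⟩, rfl⟩
    exact ⟨φ.toEquiv q, φ.mem_edge.2 hq, φ.pos_apply q⟩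

theorem LatticeIso.isEdge_edge {e : Sym2 (Pt m n)} : IsEdge (φ.edge e) ↔ IsEdge e := by
  refine and_congr (not_congr ?_) ?_
  · induction e with
    | _ p q =>
      rw [φ.edge_apply, Sym2.map_mk, Sym2.mk_isDiag_iff, Sym2.mk_isDiag_iff]
      exact φ.toEquiv.apply_eq_iff_eq
  · rw [φ.toEquiv.surjective.forall]
    refine forall_congr' fun p => ?_
    rw [φ.mem_edge, φ.seg_edge, φ.pos_apply, φ.injective.mem_set_image]

theorem LatticeIso.nonCrossing_edge {e f : Sym2 (Pt m n)} :
    NonCrossing (φ.edge e) (φ.edge f) ↔ NonCrossing e f := by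
  rw [NonCrossing, NonCrossing, φ.seg_edge, φ.seg_edge, ← Set.image_inter φ.injective,
    Set.image_subset_iff]
  refine forall₂_congr fun z _ => ?_
  simp only [Set.mem_preimage, Set.mem_image, Set.mem_ofPred_eq]
  rw [φ.toEquiv.surjective.exists]
  simp only [φ.mem_edge, φ.pos_apply, φ.injective.eq_iff]

theorem LatticeIso.isNonCrossingSet_map {s : Finset (Sym2 (Pt m n))} :
    IsNonCrossingSet (s.map φ.edge.toEmbedding) ↔ IsNonCrossingSet s := by
  simp only [IsNonCrossingSet, Finset.forall_mem_map, Equiv.coe_toEmbedding, φ.isEdge_edge,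
    φ.nonCrossing_edge, ne_eq, φ.edge.apply_eq_iff_eq]

theorem LatticeIso.maximal_map {s : Finset (Sym2 (Pt m n))} :
    Maximal IsNonCrossingSet (s.map φ.edge.toEmbedding) ↔ Maximal IsNonCrossingSet s := by
  constructor
  · intro h
    refine ⟨φ.isNonCrossingSet_map.1 h.1, fun t ht hst => ?_⟩
    exact Finset.map_subset_map.1 (h.2 (φ.isNonCrossingSet_map.2 ht) (Finset.map_subset_map.2 hst))
  · intro h
    refine maximal_of_forall_mem (φ.isNonCrossingSet_map.2 h.1) fun e he hes => ?_
    obtain ⟨e, rfl⟩ := φ.edge.surjective e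
    refine Finset.mem_map.2 ⟨e, ?_, rfl⟩
    refine Triangulation.mem_of_nonCrossing ⟨s, h⟩ (φ.isEdge_edge.1 he) fun f hf hef => ?_
    exact φ.nonCrossing_edge.1 (hes _ (Finset.mem_map.2 ⟨f, hf, rfl⟩)
      fun h => hef (φ.edge.injective h))

/-- The induced bijection between triangulations. -/
def LatticeIso.triangulation : Triangulation m n ≃ Triangulation m' n' :=
  φ.edge.finsetCongr.subtypeEquiv fun _ => φ.maximal_map.symm

theorem LatticeIso.mem_triangulation {σ : Triangulation m n} {e : Sym2 (Pt m n)} :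
    φ.edge e ∈ (φ.triangulation σ).1 ↔ e ∈ σ.1 :=
  Finset.mem_map' φ.edge.toEmbedding

theorem LatticeIso.totalLength_triangulation (σ : Triangulation m n) :
    totalLength (φ.triangulation σ) = totalLength σ := by
  refine (Finset.sum_map σ.1 φ.edge.toEmbedding edgeLength).trans ?_
  exact Finset.sum_congr rfl fun e _ => φ.edgeLength_map e

theorem LatticeIso.partitionFunction_eq (φ : LatticeIso m n m' n') (lam : ℝ) :
    partitionFunction lam m' n' = partitionFunction lam m n := by
  rw [partitionFunction, partitionFunction, ← φ.triangulation.sum_comp]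
  simp_rw [φ.totalLength_triangulation]

theorem LatticeIso.gibbs_triangulation (lam : ℝ) (σ : Triangulation m n) :
    gibbs lam (φ.triangulation σ) = gibbs lam σ := by
  rw [gibbs, gibbs, φ.totalLength_triangulation, φ.partitionFunction_eq]

/-- The reflection `(i, j) ↦ (i, n - j)`. -/
noncomputable def reflection (m n : ℕ) : LatticeIso m n m n where
  toEquiv := Equiv.prodCongr (Equiv.refl _) Fin.revPerm
  toAffineMap := AffineMap.fst.prod (AffineMap.const ℝ (ℝ × ℝ) (n : ℝ) - AffineMap.snd)
  injective := by
    intro x y h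
    have h1 := congrArg Prod.fst h
    have h2 := congrArg Prod.snd h
    simp at h1 h2
    exact Prod.ext h1 h2
  pos_apply p := by
    have h := p.2.2
    simp only [pos, Equiv.prodCongr_apply, Prod.map, Equiv.refl_apply, Fin.revPerm_apply,
      Fin.val_rev]
    rw [show n + 1 - ((p.2 : ℕ) + 1) = n - p.2 by omega, Nat.cast_sub (by omega)]
    simp
  edgeLength_map e := by
    induction e with
    | _ p q =>
      have h := p.2.2
      have h' := q.2.2
      simp only [edgeLength, Sym2.map_mk, Sym2.lift_mk, Equiv.prodCongr_apply, Prod.map,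
        Equiv.refl_apply, Fin.revPerm_apply, Fin.val_rev, Nat.dist]
      omega

/-- The transposition `(i, j) ↦ (j, i)`. -/
noncomputable def transposition (m n : ℕ) : LatticeIso m n n m where
  toEquiv := Equiv.prodComm _ _
  toAffineMap := AffineMap.snd.prod AffineMap.fst
  injective := by
    intro x y h
    have h1 := congrArg Prod.fst h
    have h2 := congrArg Prod.snd h
    simp at h1 h2
    exact Prod.ext h2 h1
  pos_apply p := by simp [pos]
  edgeLength_map e := by
    induction e with
    | _ p q =>
      simp only [edgeLength, Sym2.map_mk, Sym2.lift_mk, Equiv.prodComm_apply, Prod.fst_swap,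
        Prod.snd_swap]
      exact add_comm _ _

/-- The trap is disjoint from its reflection, because the left side of the trapezoid crosses its
own reflection. -/
theorem sum_trap_le_half {lam : ℝ} (hlam : 0 < lam) {m n r : ℕ} (hm : 1 ≤ m) (hr : r < n - r) :
    ∑ σ ∈ trap m n r, gibbs lam σ ≤ 1 / 2 := by
  set E := (reflection m n).triangulation with hE
  have hdisj : Disjoint (trap m n r) ((trap m n r).map E.toEmbedding) := by
    rw [Finset.disjoint_left]
    intro τ hτ hτ'
    obtain ⟨σ, hσ, rfl⟩ := Finset.mem_map.1 hτ'
    have hf : strip m n (0, n - r) ∈ trapBoundary m n r := mem_trapBoundary.2 (Or.inl rfl)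
    have h1 : strip m n (0, n - r) ∈ (E σ).1 := mem_trap.1 hτ hf
    have h2 : (reflection m n).edge (strip m n (0, n - r)) ∈ (E σ).1 :=
      (reflection m n).mem_triangulation.2 (mem_trap.1 hσ hf)
    have h3 : (reflection m n).edge (strip m n (0, n - r)) = strip m n (n, r) := by
      have e1 : (reflection m n).toEquiv (pt m n 0 0) = pt m n 0 n := by
        refine eq_pt ?_ ?_
        · simp [reflection, pt_fst (Nat.zero_le m)]
        · simp [reflection, pt_snd _ (Nat.zero_le n), Fin.val_rev]
      have e2 : (reflection m n).toEquiv (pt m n 1 (n - r)) = pt m n 1 r := by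
        refine eq_pt ?_ ?_
        · simp [reflection, pt_fst hm]
        · simp only [reflection, Equiv.prodCongr_apply, Prod.map, Fin.revPerm_apply, Fin.val_rev,
            pt_snd _ (Nat.sub_le n r)]
          omega
      rw [LatticeIso.edge_apply, strip, strip, Sym2.map_mk, e1, e2]
    rw [h3] at h2
    have hne : ((0, n - r) : ℕ × ℕ) ≠ (n, r) := fun h => by
      rw [Prod.mk.injEq] at h
      omega
    have h4 := (nonCrossing_strip_strip hm (x := (0, n - r)) (y := (n, r)) (Nat.zero_le n)
      (Nat.sub_le n r) le_rfl (by simp only; omega) hne).1 ((E σ).2.1.2 _ h1 _ h2 fun h =>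
        hne (strip_injOn hm (Nat.zero_le n) (Nat.sub_le n r) le_rfl (by simp only; omega) h))
    simp only [Prod.mk_le_mk] at h4
    omega
  have hsum : ∑ σ ∈ (trap m n r).map E.toEmbedding, gibbs lam σ
      = ∑ σ ∈ trap m n r, gibbs lam σ := by
    rw [Finset.sum_map]
    exact Finset.sum_congr rfl fun σ _ => (reflection m n).gibbs_triangulation lam σ
  have htot : ∑ σ ∈ (trap m n r).disjUnion _ hdisj, gibbs lam σ ≤ 1 := by
    rw [← sum_gibbs (m := m) (n := n) hlam]
    exact Finset.sum_le_sum_of_subset_of_nonneg (Finset.subset_univ _) fun σ _ _ =>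
      (gibbs_pos hlam σ).le
  rw [Finset.sum_disjUnion, hsum] at htot
  linarith

theorem isFlipAt_transposition {x : ℕ × ℕ} {σ τ : Triangulation m n} :
    IsFlipAt x.swap ((transposition m n).triangulation σ) ((transposition m n).triangulation τ) ↔
      IsFlipAt x σ τ := by
  set φ := transposition m n with hφ
  have hmid : ∀ p q : Pt m n, IsMidpoint x.swap (φ.toEquiv p) (φ.toEquiv q) ↔ IsMidpoint x p q :=
    fun p q => and_comm
  have hedge : ∀ p q : Pt m n, s(φ.toEquiv p, φ.toEquiv q) = φ.edge s(p, q) := fun p q => rfl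
  have hset : ∀ a b c d : Pt m n, (φ.triangulation τ).1 =
      insert (φ.edge s(b, d)) ((φ.triangulation σ).1.erase (φ.edge s(a, c))) ↔
      τ.1 = insert s(b, d) (σ.1.erase s(a, c)) := by
    intro a b c d
    rw [← (Finset.map_injective φ.edge.toEmbedding).eq_iff, Finset.map_insert, Finset.map_erase]
    rfl
  rw [IsFlipAt, IsFlipAt]
  simp only [φ.toEquiv.surjective.exists, hmid, hedge, φ.mem_triangulation, hset]

theorem siteUpdate_transposition (lam : ℝ) (x : ℕ × ℕ) (σ τ : Triangulation m n) :
    siteUpdate lam x.swap ((transposition m n).triangulation σ)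
      ((transposition m n).triangulation τ) = siteUpdate lam x σ τ := by
  classical
  rw [siteUpdate, siteUpdate, ← (transposition m n).triangulation.sum_comp]
  simp only [isFlipAt_transposition, LatticeIso.gibbs_triangulation, EmbeddingLike.apply_eq_iff_eq]

theorem glauber_transposition (lam : ℝ) (σ τ : Triangulation m n) :
    glauber lam n m ((transposition m n).triangulation σ)
      ((transposition m n).triangulation τ) = glauber lam m n σ τ := by
  have hmid : midpoints n m = (midpoints m n).map (Equiv.prodComm ℕ ℕ).toEmbedding := by
    ext x
    rw [Finset.mem_map_equiv]
    simp only [midpoints, Finset.mem_filter, Finset.mem_product, Finset.mem_range,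
      Equiv.prodComm_symm, Equiv.prodComm_apply, Prod.fst_swap, Prod.snd_swap]
    tauto
  rw [glauber_apply, glauber_apply, hmid, Finset.card_map, Finset.sum_map]
  congr 1
  exact Finset.sum_congr rfl fun x _ => siteUpdate_transposition lam x σ τ

theorem mixingTime_transposition_le (lam : ℝ) (m n : ℕ) :
    mixingTime lam n m ≤ mixingTime lam m n := by
  set E := (transposition m n).triangulation with hE
  have hpow : ∀ (t : ℕ) (σ τ : Triangulation m n),
      (glauber lam n m ^ t) (E σ) (E τ) = (glauber lam m n ^ t) σ τ := by
    intro t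
    induction t with
    | zero =>
      intro σ τ
      simp [Matrix.one_apply]
    | succ t ih =>
      intro σ τ
      rw [pow_succ, pow_succ, Matrix.mul_apply, Matrix.mul_apply, ← E.sum_comp]
      refine Finset.sum_congr rfl fun ρ _ => ?_
      rw [ih, glauber_transposition]
  refine sInf_le_sInf ?_
  rintro _ ⟨t, rfl, ht⟩
  refine ⟨t, rfl, fun σ => ?_⟩
  obtain ⟨σ, rfl⟩ := E.surjective σ
  refine le_of_eq_of_le ?_ (ht σ)
  rw [tvDist, tvDist, ← E.sum_comp]
  simp_rw [hpow]
  congr 1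
  refine Finset.sum_congr rfl fun τ _ => ?_
  rw [LatticeIso.gibbs_triangulation]

end Symmetry

/-! ### The lower bounds on the mixing time -/

section Mixing

variable {m n : ℕ} {lam : ℝ}

theorem pow_le_of_mixed (hlam : 1 < lam) (hm : 1 ≤ m) {r : ℕ} (hr1 : 1 ≤ r) (hr : 3 * r ≤ n)
    {t : ℕ} (ht : ∀ σ : Triangulation m n, tvDist ((glauber lam m n ^ t) σ) (gibbs lam) ≤ 1 / 4) :
    lam ^ r / 8 ≤ t := by
  have h0 : 0 < lam := by linarith
  have hn : 1 ≤ n := by omega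
  have hpos : 0 < ∑ σ ∈ trap m n r, gibbs lam σ :=
    Finset.sum_pos (fun σ _ => gibbs_pos h0 σ) (trap_nonempty hm (by omega))
  have h := bottleneck_bound (glauber_nonneg h0) (sum_glauber hm hn) (fun σ => (gibbs_pos h0 σ).le)
    (sum_gibbs h0) (gibbs_stationary hm hn) hpos (sum_trap_le_half h0 hm (by omega))
    (escape_trap_le hlam hm hr1 hr) ht
  have hpow : 0 < lam ^ r := pow_pos h0 r
  rw [← mul_div_assoc, le_div_iff₀ hpow] at h
  linarith

/-- One step does not mix: there are triangulations with and without a given edge, and a step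
changes the presence of that edge with probability at most `1/5`. -/
theorem two_le_of_mixed (hlam : 0 < lam) (hm : 1 ≤ m) (hn : 1 ≤ n) {t : ℕ}
    (ht : ∀ σ : Triangulation m n, tvDist ((glauber lam m n ^ t) σ) (gibbs lam) ≤ 1 / 4) :
    2 ≤ t := by
  classical
  have hsingle : ∀ e : Sym2 (Pt m n), IsEdge e → ∃ σ : Triangulation m n, e ∈ σ.1 := by
    intro e he
    obtain ⟨σ, hσ⟩ := exists_triangulation (s := {e}) ⟨by simpa using he, by
      intro f hf g hg hfg
      rw [Finset.mem_singleton] at hf hg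
      exact absurd (hf.trans hg.symm) hfg⟩
    exact ⟨σ, hσ (Finset.mem_singleton_self e)⟩
  obtain ⟨σ, hσ⟩ := hsingle _ (isEdge_strip hm (Nat.zero_le n) hn)
  obtain ⟨τ, hτ⟩ := hsingle _ (isEdge_strip hm hn (Nat.zero_le n))
  set e : Sym2 (Pt m n) := strip m n (0, 1) with he
  have heτ : e ∉ τ.1 := fun h => by
    have hne : ((0, 1) : ℕ × ℕ) ≠ (1, 0) := by decide
    have h1 := (nonCrossing_strip_strip hm (x := (0, 1)) (y := (1, 0)) (Nat.zero_le n) hn hn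
      (Nat.zero_le n) hne).1 (τ.2.1.2 _ h _ hτ fun h' =>
        hne (strip_injOn hm (Nat.zero_le n) hn hn (Nat.zero_le n) h'))
    simp at h1
  set A : Finset (Triangulation m n) := Finset.univ.filter fun ρ => e ∈ ρ.1 with hA
  have hrow : ∀ ρ : Triangulation m n,
      ∑ ρ', (glauber lam m n ^ t) ρ ρ' = ∑ ρ' : Triangulation m n, gibbs lam ρ' :=
    fun ρ => (sum_pow_apply (sum_glauber hm hn) t ρ).trans (sum_gibbs hlam).symm
  -- The rows of `σ` and of `τ` both give `A` its stationary probability up to `1/4`.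
  have h1 : ∑ ρ ∈ A, gibbs lam ρ ≤ ∑ ρ ∈ A, (glauber lam m n ^ t) τ ρ + 1 / 4 := by
    have h2 := sum_sub_le_half_sum_abs (hrow τ) A
    have h3 := ht τ
    rw [tvDist] at h3
    linarith
  have h2 : ∑ ρ ∈ Aᶜ, gibbs lam ρ ≤ ∑ ρ ∈ Aᶜ, (glauber lam m n ^ t) σ ρ + 1 / 4 := by
    have h2 := sum_sub_le_half_sum_abs (hrow σ) Aᶜ
    have h3 := ht σ
    rw [tvDist] at h3
    linarith
  have h3 := Finset.sum_add_sum_compl A (gibbs lam (m := m) (n := n))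
  rw [sum_gibbs hlam] at h3
  have hAc : ∀ ρ, ρ ∈ Aᶜ ↔ e ∉ ρ.1 := fun ρ => by simp [hA]
  by_contra hlt
  rcases (by omega : t = 0 ∨ t = 1) with rfl | rfl
  · have h4 : ∑ ρ ∈ A, (glauber lam m n ^ 0) τ ρ = 0 := Finset.sum_eq_zero fun ρ hρ => by
      rw [pow_zero, Matrix.one_apply_ne]
      rintro rfl
      exact heτ (Finset.mem_filter.1 hρ).2
    have h5 : ∑ ρ ∈ Aᶜ, (glauber lam m n ^ 0) σ ρ = 0 := Finset.sum_eq_zero fun ρ hρ => by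
      rw [pow_zero, Matrix.one_apply_ne]
      rintro rfl
      exact (hAc _).1 hρ hσ
    linarith
  · rw [pow_one] at h1 h2
    have h4 : ∑ ρ ∈ A, glauber lam m n τ ρ ≤ 1 / 5 := by
      refine le_of_eq_of_le (Finset.sum_congr ?_ fun _ _ => rfl)
        (sum_glauber_change_le hlam hm hn (pt m n 0 0) (pt m n 1 1) τ)
      exact Finset.filter_congr fun ρ _ => by
        change e ∈ ρ.1 ↔ ¬ (e ∈ τ.1 ↔ e ∈ ρ.1)
        tauto
    have h5 : ∑ ρ ∈ Aᶜ, glauber lam m n σ ρ ≤ 1 / 5 := by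
      refine le_of_eq_of_le (Finset.sum_congr ?_ fun _ _ => rfl)
        (sum_glauber_change_le hlam hm hn (pt m n 0 0) (pt m n 1 1) σ)
      ext ρ
      rw [hAc, Finset.mem_filter]
      change e ∉ ρ.1 ↔ ρ ∈ Finset.univ ∧ ¬ (e ∈ σ.1 ↔ e ∈ ρ.1)
      simp only [Finset.mem_univ, true_and]
      tauto
    linarith

theorem le_mixingTime {a : ℝ} (h : ∀ t : ℕ, (∀ σ : Triangulation m n,
    tvDist ((glauber lam m n ^ t) σ) (gibbs lam) ≤ 1 / 4) → a ≤ t) :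
    ENNReal.ofReal a ≤ ((mixingTime lam m n : ℕ∞) : ENNReal) := by
  rw [mixingTime]
  rcases Set.eq_empty_or_nonempty {T : ℕ∞ | ∃ t : ℕ, T = (t : ℕ∞) ∧
    ∀ σ : Triangulation m n, tvDist ((glauber lam m n ^ t) σ) (gibbs lam) ≤ 1 / 4} with h1 | h1
  · rw [h1, sInf_empty]
    simp
  · obtain ⟨t, ht, hmix⟩ := csInf_mem h1
    rw [ht, ENat.toENNReal_coe]
    exact ENNReal.ofReal_le_natCast.2 (h t hmix)

end Mixing

end LatticeTriangulation

open LatticeTriangulation in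
theorem mainTheorem3 (lam : ℝ) (hlam : 1 < lam) :
    ∃ c : ℝ, 0 < c ∧ ∀ m n : ℕ, 1 ≤ m → 1 ≤ n →
      ENNReal.ofReal (Real.exp (c * ((m : ℝ) + (n : ℝ)))) ≤
        ((LatticeTriangulation.mixingTime lam m n : ℕ∞) : ENNReal) := by
  have hl : 0 < Real.log lam := Real.log_pos hlam
  have hlog2 : 0 < Real.log 2 := Real.log_pos (by norm_num)
  have hlog8 : 0 < Real.log 8 := Real.log_pos (by norm_num)
  -- Beyond `N`, the bottleneck bound is better than `exp (n * log lam / 6)`.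
  set N : ℝ := 6 * (1 + Real.log 8 / Real.log lam) with hN
  have hN6 : 6 ≤ N := by
    have : 0 < Real.log 8 / Real.log lam := by positivity
    rw [hN]
    linarith
  have hNl : N * Real.log lam = 6 * (Real.log lam + Real.log 8) := by
    rw [hN]
    field_simp
  set c : ℝ := min (Real.log 2 / (2 * N)) (Real.log lam / 12) with hc
  have hc0 : 0 < c := lt_min (by positivity) (by positivity)
  have hc1 : c * (2 * N) ≤ Real.log 2 := by
    rw [← le_div_iff₀ (by positivity)]
    exact min_le_left _ _
  have hc2 : c ≤ Real.log lam / 12 := min_le_right _ _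
  have main : ∀ m n : ℕ, 1 ≤ m → 1 ≤ n → m ≤ n →
      ENNReal.ofReal (Real.exp (c * ((m : ℝ) + (n : ℝ)))) ≤
        ((mixingTime lam m n : ℕ∞) : ENNReal) := by
    intro m n hm hn hmn
    refine le_mixingTime fun t ht => ?_
    have hmn' : (m : ℝ) ≤ n := by exact_mod_cast hmn
    have hle : c * ((m : ℝ) + n) ≤ c * (2 * n) := mul_le_mul_of_nonneg_left (by linarith) hc0.le
    rcases le_or_gt (n : ℝ) N with hnN | hnN
    · have h1 : c * (2 * n) ≤ Real.log 2 :=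
        (mul_le_mul_of_nonneg_left (by linarith) hc0.le).trans hc1
      have h2 : (2 : ℝ) ≤ t := by exact_mod_cast two_le_of_mixed (by linarith) hm hn ht
      calc Real.exp (c * ((m : ℝ) + n)) ≤ Real.exp (Real.log 2) :=
            Real.exp_le_exp.2 (hle.trans h1)
        _ = 2 := Real.exp_log (by norm_num)
        _ ≤ t := h2
    · have hn6 : 6 < n := by exact_mod_cast hN6.trans_lt hnN
      refine le_trans ?_ (pow_le_of_mixed hlam hm (r := n / 3) (by omega) (by omega) ht)
      have hr : (n : ℝ) / 3 - 1 ≤ (n / 3 : ℕ) := by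
        have : (n : ℝ) ≤ 3 * (n / 3 : ℕ) + 3 := by exact_mod_cast (by omega : n ≤ 3 * (n / 3) + 3)
        linarith
      have hexp : lam ^ (n / 3) / 8
          = Real.exp ((n / 3 : ℕ) * Real.log lam - Real.log 8) := by
        rw [Real.exp_sub, Real.exp_nat_mul, Real.exp_log (by linarith), Real.exp_log (by norm_num)]
      rw [hexp]
      refine Real.exp_le_exp.2 (hle.trans ?_)
      have h1 : c * (2 * n) ≤ Real.log lam / 12 * (2 * n) :=
        mul_le_mul_of_nonneg_right hc2 (by positivity)
      have h2 := mul_le_mul_of_nonneg_right hr hl.le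
      have h3 := mul_le_mul_of_nonneg_right hnN.le hl.le
      rw [hNl] at h3
      linarith
  refine ⟨c, hc0, fun m n hm hn => ?_⟩
  rcases le_total m n with h | h
  · exact main m n hm hn h
  · rw [add_comm]
    exact (main n m hn hm h).trans
      (ENat.toENNReal_le.2 (mixingTime_transposition_le lam m n))
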